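/- Fix a set $I$ of internal actions, a disjoint set $E$ of external actions and a silent action $\tau\notin I\cup E$; put $\Sigma_\tau=\{\tau\}\cup I\cup E$. For a set $X$ let $\mathcal D(X)$ be the set of finitely supported probability distributions on $X$, and $\delta_x$ the point distribution at $x$. A probabilistic automaton is a tuple $P=(P,\to_P,\mu_0^P,F_P)$ with a set $P$ of states, a transition relation $\to_P\,\subseteq P\times\Sigma_\tau\times\mathcal D(P)$, an initial distribution $\mu_0^P\in\mathcal D(P)$ and a set $F_P\subseteq P$ of final states. Let $\mathbf{PAut}$ be the collection of these automata (with states in a fixed universe). The operations are, with disjoint state spaces, a fresh state $z$, and distributions on a part regarded as distributions on the whole: - $\mathbf 0=(\{x\},\emptyset,\delta_x,\emptyset)$ (deadlock) and $\mathbf 1=(\{x\},\emptyset,\delta_x,\{x\})$ (skip); - $P+Q=(P\cup Q\cup\{z\},\ \to_P\cup\to_Q\cup\{z\xrightarrow{\tau}\mu_0^P,\ z\xrightarrow{\tau}\mu_0^Q\},\ \delta_z,\ F_P\cup F_Q)$; - $P\cdot Q=(P\cup Q,\ \to_P\cup\to_Q\cup\{x\xrightarrow{\tau}\mu_0^Q\mid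 x\in F_P\},\ \mu_0^P,\ F_Q)$; - $P^*=(P\cup\{z\},\ \to_P\cup\{z\xrightarrow{\tau}\mu_0^P\}\cup\{x\xrightarrow{\tau}\delta_z\mid x\in F_P\},\ \delta_z,\ \{z\})$; - $P\oplus_p Q=(P\cup Q,\ \to_P\cup\to_Q,\ p\mu_0^P+(1-p)\mu_0^Q,\ F_P\cup F_Q)$ for $p\in[0,1]$; - $P\|Q=(P\times Q,\to,\mu_0^P\times\mu_0^Q,F_P\times F_Q)$, where $(x,y)\xrightarrow{a}\mu\times\nu$ iff either $a\in E$, $x\xrightarrow{a}\mu$ and $y\xrightarrow{a}\nu$; or $a\notin E$, $x\xrightarrow{a}\mu$ and $\nu=\delta_y$; or $a\notin E$, $y\xrightarrow{a}\nu$ and $\mu=\delta_x$. For $S\subseteq X\times\mathcal D(Y)$ write $\mu\,\overline S\,\nu$ if there are a finite family of numbers $p_n\in[0,1]$ with $\sum_n p_n=1$, points $x_n\in X$ and $\nu_n\in\mathcal D(Y)$ with $x_n\,S\,\nu_n$ for all $n$, $\mu=\sum_n p_n\delta_{x_n}$ and $\nu=\sum_n p_n\nu_n$. For weak transitions, the relation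 $\xrightarrow{\tau}$ is first extended by all pairs $(x,\delta_x)$; $\overline a$ denotes the lifting of $\xrightarrow{a}$; $\Rightarrow$ is the reflexive transitive closure of $\overline\tau$, and $\mu\stackrel{a}{\Rightarrow}\mu'$ means $\mu\Rightarrow\mu_1\mathrel{\overline a}\mu_2\Rightarrow\mu'$ for some $\mu_1,\mu_2$. A probabilistic (weak) simulation from $P$ to $Q$ is a relation $S\subseteq P\times\mathcal D(Q)$ such that (1) $\mu_0^P\,\overline S\,\nu_0'$ and $\mu_0^Q\Rightarrow\nu_0'$ for some $\nu_0'$; (2) if $x\xrightarrow{a}\mu'$ is a transition of $P$ and $x\,S\,\nu$, then $\nu\stackrel{a}{\Rightarrow}\nu'$ and $\mu'\,\overline S\,\nu'$ for some $\nu'$; (3) if $x\in F_P$ and $x\,S\,\nu$, then $\nu\Rightarrow\nu'$ for some $\nu'$ with support contained in $F_Q$. Write $P\le Q$ if there is a simulation from $P$ to $Q$, and $P\equiv Q$ if $P\le Q$ and $Q\le P$. **Theorem.** The relation $\equiv$ is an equivalence relation on $\mathbf{PAut}$, all the operations above are well defined on $\mathbf{PAut}/{\equiv}$, and $P\le Q$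 if and only if $P+Q\equiv Q$. With the induced operations, $\mathbf{PAut}/{\equiv}$ is a weak concurrent Kleene algebra, and with the choices $\oplus_p$ it is a probabilistic concurrent Kleene algebra. That is, for all $P,Q,R,P',Q'$ and all $p\in[0,1]$, the weak concurrent Kleene algebra laws hold: - $P\equiv P+P$, $\ P\equiv P+\mathbf 0$, $\ P+Q\equiv Q+P$, $\ P+(Q+R)\equiv(P+Q)+R$; - $P\equiv P\cdot\mathbf 1$, $\ P\equiv\mathbf 1\cdot P$, $\ \mathbf 0\equiv\mathbf 0\cdot P$, $\ P\cdot(Q\cdot R)\equiv(P\cdot Q)\cdot R$, $\ P\cdot R+Q\cdot R\equiv(P+Q)\cdot R$, $\ P\cdot Q+P\cdot R\le P\cdot(Q+R)$; - $P^*\equiv\mathbf 1+P\cdot P^*$, and $P\cdot Q\le Q$ implies $P^*\cdot Q\le Q$; - $P\|Q\equiv Q\|P$, $\ P\|(Q\|R)\equiv(P\|Q)\|R$, $\ (P\|Q)\cdot(P'\|Q')\le(P\cdot P')\|(Q\cdot Q')$, $\ (P\|Q)+(P\|R)\le P\|(Q+R)$; and so do the probabilistic laws: - $P\equiv P\oplus_pP$,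 $\ P\oplus_pQ\equiv Q\oplus_{1-p}P$, and $P\oplus_p(Q\oplus_qR)\equiv(P\oplus_{p'}Q)\oplus_{q'}R$ whenever $p,q,p',q'\in[0,1]$ satisfy $p'q'=p$, $(1-p')q'=(1-p)q$ and $1-q'=(1-p)(1-q)$; - $(P\oplus_pQ)\cdot R\equiv(P\cdot R)\oplus_p(Q\cdot R)$, $\ P\cdot(Q\oplus_pR)\le(P\cdot Q)\oplus_p(P\cdot R)$, $\ (P\|Q)\oplus_p(P\|R)\equiv P\|(Q\oplus_pR)$. -/

import Mathlib

universe u v w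

noncomputable section

/-- `FinDist X` is the set of finitely supported probability distributions over `X`. The point
distribution at `x` is `Convexity.StdSimplex.single x`, the image of `μ` under `f` is `μ.map f`, and
`Convexity.iConvexComb p ν` is the distribution `∑ i, p i • ν i`. -/
abbrev FinDist (X : Type u) : Type u := Convexity.StdSimplex ℝ X

namespace FinDist

/-- The point distribution at `x`. -/
abbrev dirac {X : Type u} (x : X) : FinDist X := Convexity.StdSimplex.single x

/-- The product distribution: `(μ × ν) (x, y) = μ x * ν y`. -/
def prod {X : Type u} {Y : Type v} (μ : FinDist X) (ν : FinDist Y) : FinDist (X × Y) where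
  weights := Finsupp.onFinset (μ.weights.support ×ˢ ν.weights.support)
    (fun t => μ.weights t.1 * ν.weights t.2) (by
      intro t ht
      rw [Finset.mem_product, Finsupp.mem_support_iff, Finsupp.mem_support_iff]
      exact ⟨left_ne_zero_of_mul ht, right_ne_zero_of_mul ht⟩)
  nonneg := by
    rw [Finsupp.le_def]
    intro t
    exact mul_nonneg (Convexity.StdSimplex.weights_nonneg t.1)
      (Convexity.StdSimplex.weights_nonneg t.2)
  total := by
    rw [Finsupp.onFinset_sum _ (fun _ => rfl), Finset.sum_product]
    have hν : ∑ y ∈ ν.weights.support, ν.weights y = 1 := ν.total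
    have hμ : ∑ x ∈ μ.weights.support, μ.weights x = 1 := μ.total
    simp only [← Finset.mul_sum, hν, mul_one, hμ]

/-- The distribution `p • μ + (1 - p) • ν`. -/
def mix {X : Type u} (p : unitInterval) (μ ν : FinDist X) : FinDist X :=
  Convexity.convexCombPair (p : ℝ) (1 - p) p.2.1 (sub_nonneg.2 p.2.2) (by ring) μ ν

/-- Lifting of a relation `S ⊆ X × FinDist Y` to a relation between distributions:
`μ = ∑ i, p i • δ (x i)` and `ν = ∑ i, p i • ν' i`, where `S (x i) (ν' i)` for every index `i`. -/
def Lift {X : Type u} {Y : Type v} (S : X → FinDist Y → Prop) (μ : FinDist X) (ν : FinDist Y) : Prop :=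
  ∃ (n : ℕ) (p : FinDist (Fin n)) (x : Fin n → X) (ν' : Fin n → FinDist Y),
    μ = Convexity.iConvexComb p (fun i => dirac (x i)) ∧
    (∀ i, S (x i) (ν' i)) ∧
    ν = Convexity.iConvexComb p ν'

end FinDist

/-- The set of actions `Σ_τ`: the silent action, the internal actions `I` and the external
actions `E`. -/
inductive Act (I : Type v) (E : Type w) : Type (max v w)
  | tau : Act I E
  | internal (i : I) : Act I E
  | external (e : E) : Act I E

/-- Probabilistic automata over the internal actions `I` and the external actions `E`. -/
structure PAut (I : Type v) (E : Type w) : Type (max (u + 1) v w) where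
  State : Type u
  trans : State → Act I E → FinDist State → Prop
  init : FinDist State
  final : Set State

namespace PAut

variable {I : Type v} {E : Type w}

/-! ### Operations -/

/-- `0`: one state, no transition, no final state. -/
def deadlock : PAut.{u} I E where
  State := PUnit
  trans := fun _ _ _ => False
  init := FinDist.dirac PUnit.unit
  final := ∅

/-- `1`: one state, which is final, and no transition. -/
def skip : PAut.{u} I E where
  State := PUnit
  trans := fun _ _ _ => False
  init := FinDist.dirac PUnit.unit
  final := Set.univ

/-- Transitions of `P + Q`; the new state `z` is `none`. -/
inductive AddTrans (P Q : PAut.{u} I E) :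
    Option (P.State ⊕ Q.State) → Act I E → FinDist (Option (P.State ⊕ Q.State)) → Prop
  | left {x : P.State} {a : Act I E} {μ : FinDist P.State} :
      P.trans x a μ → AddTrans P Q (some (Sum.inl x)) a (μ.map fun s => some (Sum.inl s))
  | right {y : Q.State} {a : Act I E} {ν : FinDist Q.State} :
      Q.trans y a ν → AddTrans P Q (some (Sum.inr y)) a (ν.map fun s => some (Sum.inr s))
  | startLeft : AddTrans P Q none Act.tau (P.init.map fun s => some (Sum.inl s))
  | startRight : AddTrans P Q none Act.tau (Q.init.map fun s => some (Sum.inr s))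

/-- Nondeterministic choice `P + Q`. -/
def add (P Q : PAut.{u} I E) : PAut.{u} I E where
  State := Option (P.State ⊕ Q.State)
  trans := AddTrans P Q
  init := FinDist.dirac none
  final := {s | (∃ x ∈ P.final, s = some (Sum.inl x)) ∨ (∃ y ∈ Q.final, s = some (Sum.inr y))}

/-- Transitions of `P · Q`. -/
inductive SeqTrans (P Q : PAut.{u} I E) :
    P.State ⊕ Q.State → Act I E → FinDist (P.State ⊕ Q.State) → Prop
  | left {x : P.State} {a : Act I E} {μ : FinDist P.State} :
      P.trans x a μ → SeqTrans P Q (Sum.inl x) a (μ.map Sum.inl)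
  | right {y : Q.State} {a : Act I E} {ν : FinDist Q.State} :
      Q.trans y a ν → SeqTrans P Q (Sum.inr y) a (ν.map Sum.inr)
  | pass {x : P.State} :
      x ∈ P.final → SeqTrans P Q (Sum.inl x) Act.tau (Q.init.map Sum.inr)

/-- Sequential composition `P · Q`. -/
def seq (P Q : PAut.{u} I E) : PAut.{u} I E where
  State := P.State ⊕ Q.State
  trans := SeqTrans P Q
  init := P.init.map Sum.inl
  final := Sum.inr '' Q.final

/-- Transitions of `P*`; the new state `z` is `none`. -/
inductive StarTrans (P : PAut.{u} I E) :
    Option P.State → Act I E → FinDist (Option P.State) → Prop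
  | inner {x : P.State} {a : Act I E} {μ : FinDist P.State} :
      P.trans x a μ → StarTrans P (some x) a (μ.map some)
  | start : StarTrans P none Act.tau (P.init.map some)
  | back {x : P.State} : x ∈ P.final → StarTrans P (some x) Act.tau (FinDist.dirac none)

/-- Kleene star `P*`. -/
def star (P : PAut.{u} I E) : PAut.{u} I E where
  State := Option P.State
  trans := StarTrans P
  init := FinDist.dirac none
  final := {none}

/-- Transitions of `P ⊕_p Q`. -/
inductive ChoiceTrans (P Q : PAut.{u} I E) :
    P.State ⊕ Q.State → Act I E → FinDist (P.State ⊕ Q.State) → Prop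
  | left {x : P.State} {a : Act I E} {μ : FinDist P.State} :
      P.trans x a μ → ChoiceTrans P Q (Sum.inl x) a (μ.map Sum.inl)
  | right {y : Q.State} {a : Act I E} {ν : FinDist Q.State} :
      Q.trans y a ν → ChoiceTrans P Q (Sum.inr y) a (ν.map Sum.inr)

/-- Probabilistic choice `P ⊕_p Q`: `P` with probability `p`, `Q` with probability `1 - p`. -/
def choice (p : unitInterval) (P Q : PAut.{u} I E) : PAut.{u} I E where
  State := P.State ⊕ Q.State
  trans := ChoiceTrans P Q
  init := FinDist.mix p (P.init.map Sum.inl) (Q.init.map Sum.inr)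
  final := Sum.inl '' P.final ∪ Sum.inr '' Q.final

/-- Transitions of the parallel composition that synchronises on the external actions in `A`. -/
inductive ParTrans (A : Set E) (P Q : PAut.{u} I E) :
    P.State × Q.State → Act I E → FinDist (P.State × Q.State) → Prop
  | sync {x : P.State} {y : Q.State} {a : Act I E} {μ : FinDist P.State} {ν : FinDist Q.State} :
      a ∈ Act.external '' A → P.trans x a μ → Q.trans y a ν →
        ParTrans A P Q (x, y) a (μ.prod ν)
  | left {x : P.State} {y : Q.State} {a : Act I E} {μ : FinDist P.State} :
      a ∉ Act.external '' A → P.trans x a μ →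
        ParTrans A P Q (x, y) a (μ.prod (FinDist.dirac y))
  | right {x : P.State} {y : Q.State} {a : Act I E} {ν : FinDist Q.State} :
      a ∉ Act.external '' A → Q.trans y a ν →
        ParTrans A P Q (x, y) a (FinDist.prod (FinDist.dirac x) ν)

/-- Parallel composition with frame `A`. -/
def parFrame (A : Set E) (P Q : PAut.{u} I E) : PAut.{u} I E where
  State := P.State × Q.State
  trans := ParTrans A P Q
  init := P.init.prod Q.init
  final := P.final ×ˢ Q.final

/-- Parallel composition `P ‖ Q` with synchronisation on all external actions. -/
def par (P Q : PAut.{u} I E) : PAut.{u} I E := parFrame Set.univ P Q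

/-! ### Weak transitions and simulation -/

/-- The transitions labelled by `a`, where those labelled by `τ` are extended with reflexivity. -/
def Step (P : PAut.{u} I E) (a : Act I E) (x : P.State) (μ : FinDist P.State) : Prop :=
  P.trans x a μ ∨ (a = Act.tau ∧ μ = FinDist.dirac x)

/-- `μ ⟹ μ'`: finitely many lifted `τ` steps. -/
def Weak (P : PAut.{u} I E) : FinDist P.State → FinDist P.State → Prop :=
  Relation.ReflTransGen (FinDist.Lift (P.Step Act.tau))

/-- `μ ⟹ᵃ μ'`. -/
def WeakStep (P : PAut.{u} I E) (a : Act I E) (μ μ' : FinDist P.State) : Prop :=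
  ∃ μ₁ μ₂, P.Weak μ μ₁ ∧ FinDist.Lift (P.Step a) μ₁ μ₂ ∧ P.Weak μ₂ μ'

/-- Probabilistic simulations from `P` to `Q`. -/
structure IsSimulation (P Q : PAut.{u} I E) (S : P.State → FinDist Q.State → Prop) : Prop where
  init : ∃ ν₀', FinDist.Lift S P.init ν₀' ∧ Q.Weak Q.init ν₀'
  step : ∀ x a μ' ν, P.trans x a μ' → S x ν → ∃ ν', Q.WeakStep a ν ν' ∧ FinDist.Lift S μ' ν'
  final : ∀ x ν, x ∈ P.final → S x ν →
    ∃ ν' : FinDist Q.State, (ν'.weights.support : Set Q.State) ⊆ Q.final ∧ Q.Weak ν ν'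

/-- `P ≤ Q`: there is a simulation from `P` to `Q`. -/
def SimLE (P Q : PAut.{u} I E) : Prop := ∃ S, IsSimulation P Q S

/-- `P ≡ Q`: simulation equivalence. -/
def SimEquiv (P Q : PAut.{u} I E) : Prop := SimLE P Q ∧ SimLE Q P

end PAut

/-! ### The algebras -/

/-- Weak concurrent Kleene algebras. The order `x ≤ y` is the natural one, `x + y = y`. -/
class WeakConcurrentKleeneAlgebra (K : Type u) extends Add K, Mul K, Zero K, One K where
  par : K → K → K
  star : K → K
  add_idem : ∀ x : K, x = x + x
  add_deadlock : ∀ x : K, x = x + 0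
  add_comm : ∀ x y : K, x + y = y + x
  add_assoc : ∀ x y z : K, x + (y + z) = (x + y) + z
  mul_skip : ∀ x : K, x = x * 1
  skip_mul : ∀ x : K, x = 1 * x
  deadlock_mul : ∀ x : K, 0 = 0 * x
  mul_assoc : ∀ x y z : K, x * (y * z) = (x * y) * z
  add_mul : ∀ x y z : K, x * z + y * z = (x + y) * z
  mul_add_sub : ∀ x y z : K, (x * y + x * z) + x * (y + z) = x * (y + z)
  star_unfold : ∀ x : K, star x = 1 + x * star x
  star_induction : ∀ x y : K, x * y + y = y → star x * y + y = y
  par_comm : ∀ x y : K, par x y = par y x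
  par_assoc : ∀ x y z : K, par x (par y z) = par (par x y) z
  exchange : ∀ x y x' y' : K,
    par x y * par x' y' + par (x * x') (y * y') = par (x * x') (y * y')
  par_add_sub : ∀ x y z : K, (par x y + par x z) + par x (y + z) = par x (y + z)

/-- Probabilistic concurrent Kleene algebras; `choice p x y` is `x ⊕_p y`. -/
class ProbConcurrentKleeneAlgebra (K : Type u) extends WeakConcurrentKleeneAlgebra K where
  choice : unitInterval → K → K → K
  choice_idem : ∀ (p : unitInterval) (x : K), x = choice p x x
  choice_comm : ∀ (p : unitInterval) (x y : K), choice p x y = choice (unitInterval.symm p) y x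
  choice_assoc : ∀ (p q p' q' : unitInterval) (x y z : K),
    (p' * q' : ℝ) = p → ((1 - p') * q' : ℝ) = (1 - p) * q → (1 - q' : ℝ) = (1 - p) * (1 - q) →
      choice p x (choice q y z) = choice q' (choice p' x y) z
  choice_mul : ∀ (p : unitInterval) (x y z : K), choice p x y * z = choice p (x * z) (y * z)
  mul_choice_sub : ∀ (p : unitInterval) (x y z : K),
    x * choice p y z + choice p (x * y) (x * z) = choice p (x * y) (x * z)
  par_choice : ∀ (p : unitInterval) (x y z : K),
    choice p (par x y) (par x z) = par x (choice p y z)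

end

/-!
A lifting `Lift S μ ν` is the same as a kernel `g` with `g x` in the convex hull of `{ξ | S x ξ}`
for every `x` in the support of `μ` and `ν = ∑ x, μ x • g x`: disintegrate the index set of the
lifting along `i ↦ x i`. Hence liftings are closed under convex combinations, can be pulled back
along maps and compose, and a simulation matches not only transitions of states but also weak
transitions and termination of distributions. The union of all simulations is again one, which
extends to a transitive relation on distributions whose instance at the initial distributions is
`≤`.

Every law is then a simulation between two explicit automata. Most simulations are graphs of maps of
states. For `P · (Q ⊕_p R) ≤ (P · Q) ⊕_p (P · R)` the choice is made after `P` on the left and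
before it on the right, so a state `x` of `P` is simulated by the mixture of its two copies on the
right. For star induction, the new state of `P*` is simulated by whatever simulates the initial
distribution of `Q`, and a state of `P` by whatever simulates it in `P · Q`; returning to the start
is then matched because entering `Q` in `P · Q` is.
-/

noncomputable section

open Convexity

attribute [local simp] StdSimplex.map_map

namespace FinDist

variable {T X X' Y Y' Z : Type*}

theorem weights_iConvexComb (μ : FinDist X) (f : X → FinDist Y) (y : Y) :
    (μ.iConvexComb f).weights y = μ.weights.sum fun x r => r * (f x).weights y := by
  rw [iConvexComb, StdSimplex.weights_sConvexComb, StdSimplex.weights_map,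
    Finsupp.sum_mapDomain_index (by simp) (by simp [add_smul])]
  simp [Finsupp.sum]

theorem weights_iConvexComb_ne_zero_iff {μ : FinDist X} {f : X → FinDist Y} {y : Y} :
    (μ.iConvexComb f).weights y ≠ 0 ↔ ∃ x, μ.weights x ≠ 0 ∧ (f x).weights y ≠ 0 := by
  rw [weights_iConvexComb, Finsupp.sum, ne_eq, Finset.sum_eq_zero_iff_of_nonneg
    (fun x _ => mul_nonneg (StdSimplex.weights_nonneg x) (StdSimplex.weights_nonneg y))]
  simp

theorem weights_dirac_ne_zero_iff {x y : X} : (dirac x).weights y ≠ 0 ↔ y = x := by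
  classical
  simp [Finsupp.single_apply, eq_comm]

@[simp] theorem iConvexComb_dirac (μ : FinDist X) (f : X → Y) :
    μ.iConvexComb (fun x => dirac (f x)) = μ.map f := by
  classical
  ext y
  rw [weights_iConvexComb, StdSimplex.weights_map, Finsupp.mapDomain, Finsupp.sum_apply]
  simp [Finsupp.single_apply]

@[simp] theorem map_iConvexComb (μ : FinDist T) (f : T → FinDist X) (g : X → Y) :
    (μ.iConvexComb f).map g = μ.iConvexComb fun t => (f t).map g :=
  Convexity.map_iConvexComb μ f

@[simp] theorem iConvexComb_iConvexComb (μ : FinDist T) (f : T → FinDist X) (g : X → FinDist Y) :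
    (μ.iConvexComb f).iConvexComb g = μ.iConvexComb fun t => (f t).iConvexComb g :=
  (iConvexComb_assoc μ f g).symm

theorem iConvexComb_dirac_self (μ : FinDist X) : μ.iConvexComb dirac = μ :=
  (iConvexComb_dirac μ id).trans (StdSimplex.map_id μ)

theorem weights_map_ne_zero_iff {μ : FinDist X} {f : X → Y} {y : Y} :
    (μ.map f).weights y ≠ 0 ↔ ∃ x, μ.weights x ≠ 0 ∧ f x = y := by
  simp only [← iConvexComb_dirac, weights_iConvexComb_ne_zero_iff, weights_dirac_ne_zero_iff,
    eq_comm]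

theorem prod_eq_iConvexComb (μ : FinDist X) (ν : FinDist Y) :
    μ.prod ν = μ.iConvexComb fun x => ν.map (Prod.mk x) := by
  classical
  ext ⟨x, y⟩
  have weights_map_mk (x' : X) :
      (ν.map (Prod.mk x')).weights (x, y) = if x' = x then ν.weights y else 0 := by
    split_ifs with h
    · subst h
      exact Finsupp.mapDomain_apply (Prod.mk_right_injective x') _ _
    · exact not_not.1 (mt weights_map_ne_zero_iff.1 (by simp [h]))
  simp only [weights_iConvexComb, weights_map_mk]
  simp +contextual [prod, Finsupp.sum]

@[simp] theorem prod_dirac (μ : FinDist X) (y : Y) : μ.prod (dirac y) = μ.map (·, y) := by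
  simp [prod_eq_iConvexComb]

@[simp] theorem dirac_prod (x : X) (ν : FinDist Y) : (dirac x).prod ν = ν.map (Prod.mk x) := by
  simp [prod_eq_iConvexComb]

theorem map_swap_prod (μ : FinDist X) (ν : FinDist Y) :
    (μ.prod ν).map Prod.swap = ν.prod μ := by
  ext ⟨y, x⟩
  exact (Finsupp.mapDomain_apply Prod.swap_injective _ (x, y)).trans (mul_comm _ _)

theorem prod_eq_iConvexComb_right (μ : FinDist X) (ν : FinDist Y) :
    μ.prod ν = ν.iConvexComb fun y => μ.map (·, y) := by
  simp [← map_swap_prod ν μ, prod_eq_iConvexComb]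

@[simp] theorem iConvexComb_prod (θ : FinDist T) (f : T → FinDist X) (ν : FinDist Y) :
    (θ.iConvexComb f).prod ν = θ.iConvexComb fun t => (f t).prod ν := by
  simp [prod_eq_iConvexComb]

@[simp] theorem map_prod (f : X → X') (μ : FinDist X) (ν : FinDist Y) :
    FinDist.prod (μ.map f) ν = (μ.prod ν).map fun t => (f t.1, t.2) := by
  simp [prod_eq_iConvexComb, ← iConvexComb_dirac]

@[simp] theorem prod_map (g : Y → Y') (μ : FinDist X) (ν : FinDist Y) :
    μ.prod (ν.map g) = (μ.prod ν).map fun t => (t.1, g t.2) := by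
  simp [prod_eq_iConvexComb]

@[simp] theorem map_prodAssoc_symm_prod (μ : FinDist X) (ν : FinDist Y) (ξ : FinDist Z) :
    (μ.prod (ν.prod ξ)).map (Equiv.prodAssoc X Y Z).symm = (μ.prod ν).prod ξ := by
  simp [prod_eq_iConvexComb, ← iConvexComb_dirac]

/-! ### Mixtures -/

@[simp] theorem mix_self (p : unitInterval) (μ : FinDist X) : mix p μ μ = μ :=
  convexCombPair_same ..

theorem mix_symm (p : unitInterval) (μ ν : FinDist X) :
    mix (unitInterval.symm p) ν μ = mix p μ ν := by
  ext x
  simp [mix, add_comm]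

theorem mix_assoc {p q p' q' : unitInterval} (h₁ : (p' * q' : ℝ) = p)
    (h₂ : ((1 - p') * q' : ℝ) = (1 - p) * q) (h₃ : (1 - q' : ℝ) = (1 - p) * (1 - q))
    (μ ν ξ : FinDist X) : mix p μ (mix q ν ξ) = mix q' (mix p' μ ν) ξ := by
  ext x
  simp only [mix, StdSimplex.weights_convexCombPair, Finsupp.add_apply, Finsupp.smul_apply,
    smul_eq_mul]
  linear_combination (-μ.weights x) * h₁ - ν.weights x * h₂ - ξ.weights x * h₃

@[simp] theorem map_mix (p : unitInterval) (μ ν : FinDist X) (f : X → Y) :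
    (mix p μ ν).map f = mix p (μ.map f) (ν.map f) :=
  (StdSimplex.isAffineMap_map ℝ f).map_convexCombPair ..

@[simp] theorem mix_iConvexComb (p : unitInterval) (μ ν : FinDist X) (f : X → FinDist Y) :
    (mix p μ ν).iConvexComb f = mix p (μ.iConvexComb f) (ν.iConvexComb f) := by
  rw [iConvexComb, map_mix]
  exact sConvexComb_convexCombPair ..

theorem iConvexComb_mix_dirac (p : unitInterval) (μ : FinDist X) (f g : X → Y) :
    (μ.iConvexComb fun x => mix p (dirac (f x)) (dirac (g x))) = mix p (μ.map f) (μ.map g) := by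
  rw [← iConvexComb_dirac, ← iConvexComb_dirac]
  exact iConvexComb_convexCombPair_comm ..

@[simp] theorem prod_mix (p : unitInterval) (μ : FinDist X) (ν ξ : FinDist Y) :
    μ.prod (mix p ν ξ) = mix p (μ.prod ν) (μ.prod ξ) := by
  simp only [prod_eq_iConvexComb_right, mix_iConvexComb]

/-! ### Reindexing and disintegration -/

theorem exists_fin_map_eq (θ : FinDist T) :
    ∃ (n : ℕ) (q : FinDist (Fin n)) (e : Fin n → T), (∀ i, θ.weights (e i) ≠ 0) ∧ q.map e = θ := by
  let e (i : Fin θ.weights.support.card) : T := θ.weights.support.equivFin.symm i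
  have exists_e_eq {t : T} (ht : θ.weights t ≠ 0) : ∃ i, e i = t :=
    ⟨θ.weights.support.equivFin ⟨t, Finsupp.mem_support_iff.2 ht⟩, by simp [e]⟩
  have : Nonempty (Fin θ.weights.support.card) :=
    Fin.pos_iff_nonempty.1 θ.support_weights_nonempty.card_pos
  refine ⟨_, θ.map (Function.invFun e), e,
    fun i => Finsupp.mem_support_iff.1 (Subtype.coe_prop _), ?_⟩
  calc (θ.map (Function.invFun e)).map e
      = θ.iConvexComb fun t => dirac (e (Function.invFun e t)) := by
        rw [StdSimplex.map_map, iConvexComb_dirac]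
    _ = θ.iConvexComb dirac :=
        iConvexComb_congr fun t ht => congrArg dirac (Function.invFun_eq (exists_e_eq ht))
    _ = θ := iConvexComb_dirac_self θ

theorem weights_map_eq_sum_filter (θ : FinDist T) (g : T → X) (x : X)
    [DecidablePred (· ∈ g ⁻¹' {x})] :
    (θ.map g).weights x = (θ.weights.filter (· ∈ g ⁻¹' {x})).sum fun _ r => r := by
  classical
  rw [StdSimplex.weights_map, Finsupp.mapDomain, Finsupp.sum_apply, Finsupp.sum, Finsupp.sum,
    Finsupp.support_filter, Finset.sum_filter]
  simp +contextual [Finsupp.single_apply]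

theorem exists_disintegration (θ : FinDist T) (g : T → X) :
    ∃ κ : X → FinDist T, (θ.map g).iConvexComb κ = θ ∧
      ∀ x t, (θ.map g).weights x ≠ 0 → (κ x).weights t ≠ 0 → g t = x := by
  classical
  let κ (x : X) : FinDist T :=
    if h : ∃ t ∈ g ⁻¹' {x}, θ.weights t ≠ 0 then θ.restrict _ h else θ
  have κ_eq {x : X} (h : ∃ t ∈ g ⁻¹' {x}, θ.weights t ≠ 0) : κ x = θ.restrict _ h := dif_pos h
  have nonempty_fibre {x : X} (hx : (θ.map g).weights x ≠ 0) :
      ∃ t ∈ g ⁻¹' {x}, θ.weights t ≠ 0 := by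
    obtain ⟨t, ht, rfl⟩ := weights_map_ne_zero_iff.1 hx
    exact ⟨t, rfl, ht⟩
  have of_weights_ne_zero (x : X) (t : T) (hx : (θ.map g).weights x ≠ 0)
      (ht : (κ x).weights t ≠ 0) : g t = x := by
    rw [κ_eq (nonempty_fibre hx), ← Finsupp.mem_support_iff,
      StdSimplex.support_weights_restrict] at ht
    exact (Finset.mem_filter.1 ht).2
  refine ⟨κ, ?_, of_weights_ne_zero⟩
  ext t
  rw [weights_iConvexComb, Finsupp.sum, Finset.sum_eq_single (g t)]
  · by_cases hx : (θ.map g).weights (g t) = 0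
    · have ht : θ.weights t = 0 :=
        not_not.1 fun ht => weights_map_ne_zero_iff.2 ⟨t, ht, rfl⟩ hx
      rw [hx, ht, zero_mul]
    · rw [κ_eq (nonempty_fibre hx), StdSimplex.weights_restrict, ← weights_map_eq_sum_filter,
        Finsupp.smul_apply, Finsupp.filter_apply_pos _ _ (by simp), smul_eq_mul,
        mul_inv_cancel_left₀ hx]
  · intro x hx hxt
    have : (κ x).weights t = 0 := not_not.1 fun ht =>
      hxt (of_weights_ne_zero x t (Finsupp.mem_support_iff.1 hx) ht).symm
    rw [this, mul_zero]
  · simp +contextual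

/-! ### Convex relations -/

/-- A relation between distributions is convex if it is a convex set of pairs, that is, if it is
closed under convex combinations with the same coefficients on both sides. -/
def IsConvexRel (R : FinDist X → FinDist Y → Prop) : Prop :=
  IsConvexSet ℝ {t : FinDist X × FinDist Y | R t.1 t.2}

namespace IsConvexRel

variable {R : FinDist X → FinDist Y → Prop} {R' : FinDist Y → FinDist Z → Prop}

theorem of_mix (h : ∀ p μ μ' ν ν', R μ ν → R μ' ν' → R (mix p μ μ') (mix p ν ν')) :
    IsConvexRel R := by
  refine .of_convexCombPair_mem fun a b ha hb hab t ht t' ht' => ?_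
  obtain rfl : b = 1 - a := eq_sub_of_add_eq' hab
  simpa [FinDist.mix] using h ⟨a, ha, sub_nonneg.1 hb⟩ t.1 t'.1 t.2 t'.2 ht ht'

protected theorem iConvexComb (hR : IsConvexRel R) {θ : FinDist T} {f : T → FinDist X}
    {g : T → FinDist Y} (h : ∀ t, θ.weights t ≠ 0 → R (f t) (g t)) :
    R (θ.iConvexComb f) (θ.iConvexComb g) := by
  simpa using hR.iConvexComb_mem (f := fun t => (f t, g t)) h

protected theorem mix (hR : IsConvexRel R) (p : unitInterval) {μ μ' : FinDist X}
    {ν ν' : FinDist Y} (h : R μ ν) (h' : R μ' ν') : R (mix p μ μ') (mix p ν ν') := by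
  simpa [FinDist.mix] using hR.convexCombPair_mem (x := (μ, ν)) (y := (μ', ν')) h h' p.2.1
    (sub_nonneg.2 p.2.2) (add_sub_cancel _ _)

theorem comp (hR : IsConvexRel R) (hR' : IsConvexRel R') : IsConvexRel (Relation.Comp R R') :=
  of_mix fun p _ _ _ _ ⟨_, h₁, h₂⟩ ⟨_, h₁', h₂'⟩ => ⟨_, hR.mix p h₁ h₁', hR'.mix p h₂ h₂'⟩

theorem flip (hR : IsConvexRel R) : IsConvexRel (flip R) :=
  of_mix fun p _ _ _ _ h h' => hR.mix p h h'

theorem reflTransGen {R : FinDist X → FinDist X → Prop} (hR : IsConvexRel R) (hrefl : ∀ μ, R μ μ) :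
    IsConvexRel (Relation.ReflTransGen R) :=
  of_mix fun p _ μ' ν _ h h' =>
    (h.lift (FinDist.mix p · μ') fun _ _ hstep => hR.mix p hstep (hrefl _)).trans
      (h'.lift (FinDist.mix p ν) fun _ _ hstep => hR.mix p (hrefl _) hstep)

theorem of_mem_convexHull (hR : IsConvexRel R) {s : Set (FinDist X)} {t : Set (FinDist Y)}
    (h : ∀ μ ∈ s, ∀ ν ∈ t, R μ ν) {μ : FinDist X} {ν : FinDist Y} (hμ : μ ∈ convexHull ℝ s)
    (hν : ν ∈ convexHull ℝ t) : R μ ν := by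
  have convex_left (ν : FinDist Y) : IsConvexSet ℝ {μ | R μ ν} := fun w hw => by
    simpa using hR.iConvexComb (θ := w) (f := id) (g := fun _ => ν)
      fun μ hμ => hw (Finsupp.mem_support_iff.2 hμ)
  have convex_right (μ : FinDist X) : IsConvexSet ℝ {ν | R μ ν} := fun w hw => by
    simpa using hR.iConvexComb (θ := w) (f := fun _ => μ) (g := id)
      fun ν hν => hw (Finsupp.mem_support_iff.2 hν)
  exact convexHull_min
    (fun μ hμ => convexHull_min (h μ hμ) (convex_right μ) hν) (convex_left ν) hμ

end IsConvexRel

/-! ### Lifting of relations -/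

namespace Lift

variable {S : X → FinDist Y → Prop} {μ : FinDist X} {ν : FinDist Y}

theorem of_map (θ : FinDist T) {f : T → X} {g : T → FinDist Y}
    (h : ∀ t, θ.weights t ≠ 0 → S (f t) (g t)) : Lift S (θ.map f) (θ.iConvexComb g) := by
  obtain ⟨n, q, e, he, rfl⟩ := exists_fin_map_eq θ
  exact ⟨n, q, f ∘ e, g ∘ e, by simp, fun i => h _ (he i), by simp⟩

theorem of_forall_rel (μ : FinDist X) {g : X → FinDist Y} (h : ∀ x, S x (g x)) :
    Lift S μ (μ.iConvexComb g) := by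
  simpa using of_map μ (f := id) fun x _ => h x

theorem of_rel {x : X} (h : S x ν) : Lift S (dirac x) ν := by
  simpa using of_map (dirac ()) (f := fun _ => x) (g := fun _ => ν) (fun _ _ => h)

protected theorem isConvexRel (S : X → FinDist Y → Prop) : IsConvexRel (Lift S) := by
  refine .of_mix ?_
  rintro p _ _ _ _ ⟨m, q, x, ξ, rfl, hS, rfl⟩ ⟨n, q', x', ξ', rfl, hS', rfl⟩
  simpa using
    of_map (mix p (q.map Sum.inl) (q'.map Sum.inr)) (f := Sum.elim x x') (g := Sum.elim ξ ξ')
      (by rintro (i | j) -; exacts [hS i, hS' j])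

theorem of_iConvexComb {f : T → FinDist X} {g : T → FinDist Y} {θ : FinDist T}
    (h : ∀ t, θ.weights t ≠ 0 → Lift S (f t) (g t)) :
    Lift S (θ.iConvexComb f) (θ.iConvexComb g) :=
  (Lift.isConvexRel S).iConvexComb h

theorem of_mem_convexHull {x : X} (h : ν ∈ convexHull ℝ {ξ | S x ξ}) : Lift S (dirac x) ν :=
  (Lift.isConvexRel S).of_mem_convexHull (s := {dirac x}) (fun _ hμ _ hξ => hμ ▸ of_rel hξ)
    (subset_convexHull_self rfl) h

end Lift

theorem lift_iff_exists_kernel {S : X → FinDist Y → Prop} {μ : FinDist X} {ν : FinDist Y} :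
    Lift S μ ν ↔ ∃ g : X → FinDist Y,
      (∀ x, μ.weights x ≠ 0 → g x ∈ convexHull ℝ {ξ | S x ξ}) ∧ ν = μ.iConvexComb g := by
  constructor
  · rintro ⟨n, q, x, ξ, rfl, hS, rfl⟩
    rw [iConvexComb_dirac]
    obtain ⟨κ, hκ, hκ'⟩ := exists_disintegration q x
    refine ⟨fun y => (κ y).iConvexComb ξ, fun y hy => ?_, ?_⟩
    · refine IsConvexSet.convexHull.iConvexComb_mem fun i hi => subset_convexHull_self ?_
      obtain rfl := hκ' y i hy hi
      exact hS i
    · rw [← iConvexComb_iConvexComb, hκ]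
  · rintro ⟨g, hg, rfl⟩
    simpa only [iConvexComb_dirac_self] using
      Lift.of_iConvexComb fun x hx => Lift.of_mem_convexHull (hg x hx)

theorem lift_map_left_iff {S : X → FinDist Y → Prop} {θ : FinDist T} {f : T → X} {ν : FinDist Y} :
    Lift S (θ.map f) ν ↔ Lift (fun t => S (f t)) θ ν := by
  constructor
  · intro h
    obtain ⟨g, hg, rfl⟩ := lift_iff_exists_kernel.1 h
    refine lift_iff_exists_kernel.2 ⟨g ∘ f, fun t ht => ?_, iConvexComb_map ..⟩
    exact hg (f t) (weights_map_ne_zero_iff.2 ⟨t, ht, rfl⟩)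
  · rintro ⟨n, q, x, ξ, rfl, hS, rfl⟩
    exact ⟨n, q, f ∘ x, ξ, by simp, hS, rfl⟩

namespace Lift

variable {S : X → FinDist Y → Prop} {μ : FinDist X} {ν : FinDist Y}

theorem exists_iConvexComb {θ : FinDist T} {f : T → FinDist X} (h : Lift S (θ.iConvexComb f) ν) :
    ∃ g : T → FinDist Y, (∀ t, θ.weights t ≠ 0 → Lift S (f t) (g t)) ∧ ν = θ.iConvexComb g := by
  obtain ⟨g, hg, rfl⟩ := lift_iff_exists_kernel.1 h
  refine ⟨fun t => (f t).iConvexComb g, fun t ht => ?_, iConvexComb_iConvexComb ..⟩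
  exact lift_iff_exists_kernel.2
    ⟨g, fun x hx => hg x (weights_iConvexComb_ne_zero_iff.2 ⟨t, ht, hx⟩), rfl⟩

theorem rel_of_rel {R : FinDist X → FinDist Y → Prop} (h : Lift S μ ν) (hR : IsConvexRel R)
    (hSR : ∀ x ξ, S x ξ → R (dirac x) ξ) : R μ ν := by
  obtain ⟨n, q, x, ξ, rfl, hS, rfl⟩ := h
  exact hR.iConvexComb fun i _ => hSR _ _ (hS i)

theorem rel_of_rel₂ {S' : X → FinDist Z → Prop} {R : FinDist Y → FinDist Z → Prop} {ξ : FinDist Z}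
    (h : Lift S μ ν) (h' : Lift S' μ ξ) (hR : IsConvexRel R)
    (hSR : ∀ x ν ξ, S x ν → S' x ξ → R ν ξ) : R ν ξ := by
  obtain ⟨g, hg, rfl⟩ := lift_iff_exists_kernel.1 h
  obtain ⟨g', hg', rfl⟩ := lift_iff_exists_kernel.1 h'
  exact hR.iConvexComb fun x hx =>
    hR.of_mem_convexHull (fun ν hν ξ hξ => hSR x ν ξ hν hξ) (hg x hx) (hg' x hx)

theorem mono {S' : X → FinDist Y → Prop} (h : Lift S μ ν) (hSS' : ∀ x ξ, S x ξ → S' x ξ) :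
    Lift S' μ ν :=
  h.rel_of_rel (Lift.isConvexRel S') fun x ξ hξ => of_rel (hSS' x ξ hξ)

theorem map_right (h : Lift S μ ν) (f : Y → Z) :
    Lift (fun x ξ => ∃ η, S x η ∧ ξ = η.map f) μ (ν.map f) := by
  obtain ⟨n, q, x, η, rfl, hS, rfl⟩ := h
  exact ⟨n, q, x, fun i => (η i).map f, rfl, fun i => ⟨η i, hS i, rfl⟩, by simp⟩

protected theorem comp {S' : Y → FinDist Z → Prop} {ξ : FinDist Z} (h : Lift S μ ν)
    (h' : Lift S' ν ξ) : Lift (fun x ζ => ∃ η, S x η ∧ Lift S' η ζ) μ ξ := by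
  obtain ⟨n, q, x, η, rfl, hS, rfl⟩ := h
  obtain ⟨g, hg, rfl⟩ := h'.exists_iConvexComb
  rw [iConvexComb_dirac]
  exact of_map q fun i hi => ⟨η i, hS i, hg i hi⟩

end Lift

end FinDist

namespace PAut

open FinDist

variable {I : Type v} {E : Type w} {P P' Q Q' R : PAut.{u} I E} {a : Act I E}

/-! ### Weak transitions -/

theorem lift_step_refl (μ : FinDist P.State) : Lift (P.Step Act.tau) μ μ := by
  simpa only [iConvexComb_dirac_self] using
    Lift.of_forall_rel μ (S := P.Step Act.tau) (g := dirac) fun _ => .inr ⟨rfl, rfl⟩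

theorem weak_isConvexRel (P : PAut.{u} I E) : IsConvexRel P.Weak :=
  (Lift.isConvexRel _).reflTransGen lift_step_refl

theorem weakStep_isConvexRel (P : PAut.{u} I E) (a : Act I E) : IsConvexRel (P.WeakStep a) :=
  .of_mix fun p _ _ _ _ ⟨_, _, h₁, h₂, h₃⟩ ⟨_, _, h₁', h₂', h₃'⟩ =>
    ⟨_, _, P.weak_isConvexRel.mix p h₁ h₁', (Lift.isConvexRel _).mix p h₂ h₂',
      P.weak_isConvexRel.mix p h₃ h₃'⟩

protected theorem Weak.refl (μ : FinDist P.State) : P.Weak μ μ :=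
  Relation.ReflTransGen.refl

theorem Weak.of_trans {x : P.State} {μ : FinDist P.State} (h : P.trans x Act.tau μ) :
    P.Weak (dirac x) μ :=
  .single (.of_rel (.inl h))

theorem weak_map_of_forall_weak_dirac {X : Type*} {f : X → P.State} {μ : FinDist X}
    {ν : FinDist P.State} (h : ∀ x, μ.weights x ≠ 0 → P.Weak (dirac (f x)) ν) :
    P.Weak (μ.map f) ν := by
  simpa using P.weak_isConvexRel.iConvexComb (f := fun x => dirac (f x)) (g := fun _ => ν) h

theorem WeakStep.of_trans {x : P.State} {μ : FinDist P.State} (h : P.trans x a μ) :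
    P.WeakStep a (dirac x) μ :=
  ⟨_, _, .refl _, .of_rel (.inl h), .refl _⟩

theorem WeakStep.trans_weak {μ₁ μ₂ μ₃ : FinDist P.State} (h : P.WeakStep a μ₁ μ₂)
    (h' : P.Weak μ₂ μ₃) : P.WeakStep a μ₁ μ₃ :=
  let ⟨_, _, h₁, h₂, h₃⟩ := h
  ⟨_, _, h₁, h₂, h₃.trans h'⟩

theorem Weak.trans_weakStep {μ₁ μ₂ μ₃ : FinDist P.State} (h : P.Weak μ₁ μ₂)
    (h' : P.WeakStep a μ₂ μ₃) : P.WeakStep a μ₁ μ₃ :=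
  let ⟨_, _, h₁, h₂, h₃⟩ := h'
  ⟨_, _, h.trans h₁, h₂, h₃⟩

theorem weakStep_tau_iff {μ μ' : FinDist P.State} : P.WeakStep Act.tau μ μ' ↔ P.Weak μ μ' :=
  ⟨fun ⟨_, _, h₁, h₂, h₃⟩ => (h₁.tail h₂).trans h₃, fun h => ⟨_, _, h, lift_step_refl _, .refl _⟩⟩

section Map

variable {f : P.State → Q.State} {μ μ' : FinDist P.State}

theorem lift_step_map (hf : ∀ x μ, P.trans x a μ → Q.trans (f x) a (μ.map f))
    (h : Lift (P.Step a) μ μ') : Lift (Q.Step a) (μ.map f) (μ'.map f) := by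
  obtain ⟨n, q, x, ξ, rfl, hξ, rfl⟩ := h
  refine ⟨n, q, f ∘ x, fun i => (ξ i).map f, by simp, fun i => ?_, by simp⟩
  obtain hi | ⟨ha, hi⟩ := hξ i
  · exact .inl (hf _ _ hi)
  · exact .inr ⟨ha, by simp [hi]⟩

theorem Weak.map (hf : ∀ x μ, P.trans x Act.tau μ → Q.trans (f x) Act.tau (μ.map f))
    (h : P.Weak μ μ') : Q.Weak (μ.map f) (μ'.map f) :=
  h.lift (StdSimplex.map f) fun _ _ => lift_step_map hf

theorem WeakStep.map (hτ : ∀ x μ, P.trans x Act.tau μ → Q.trans (f x) Act.tau (μ.map f))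
    (hf : ∀ x μ, P.trans x a μ → Q.trans (f x) a (μ.map f)) (h : P.WeakStep a μ μ') :
    Q.WeakStep a (μ.map f) (μ'.map f) :=
  let ⟨_, _, h₁, h₂, h₃⟩ := h
  ⟨_, _, h₁.map hτ, lift_step_map hf h₂, h₃.map hτ⟩

end Map

/-- From `μ`, silent steps can lead to a distribution on final states: condition (3) on
simulations. -/
def CanTerminate (P : PAut.{u} I E) (μ : FinDist P.State) : Prop :=
  ∃ μ' : FinDist P.State, (μ'.weights.support : Set P.State) ⊆ P.final ∧ P.Weak μ μ'

theorem canTerminate_dirac {x : P.State} (hx : x ∈ P.final) : P.CanTerminate (dirac x) :=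
  ⟨_, fun y hy => by
    rwa [weights_dirac_ne_zero_iff.1 (Finsupp.mem_support_iff.1 hy)], .refl _⟩

theorem CanTerminate.of_weak {μ μ' : FinDist P.State} (h : P.Weak μ μ') (h' : P.CanTerminate μ') :
    P.CanTerminate μ :=
  let ⟨_, hfinal, hweak⟩ := h'
  ⟨_, hfinal, h.trans hweak⟩

theorem CanTerminate.map {f : P.State → Q.State} {μ : FinDist P.State}
    (hτ : ∀ x μ, P.trans x Act.tau μ → Q.trans (f x) Act.tau (μ.map f))
    (hfinal : ∀ x ∈ P.final, f x ∈ Q.final) (h : P.CanTerminate μ) : Q.CanTerminate (μ.map f) := by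
  obtain ⟨μ', hμ', hweak⟩ := h
  refine ⟨μ'.map f, fun y hy => ?_, hweak.map hτ⟩
  obtain ⟨x, hx, rfl⟩ := weights_map_ne_zero_iff.1 (Finsupp.mem_support_iff.1 hy)
  exact hfinal x (hμ' (Finsupp.mem_support_iff.2 hx))

theorem isConvexSet_canTerminate (P : PAut.{u} I E) :
    Convexity.IsConvexSet ℝ {μ | P.CanTerminate μ} := by
  intro w hw
  choose! f hfinal hweak using hw
  refine ⟨w.iConvexComb f, fun x hx => ?_, ?_⟩
  · obtain ⟨μ, hμ, hx⟩ := weights_iConvexComb_ne_zero_iff.1 (Finsupp.mem_support_iff.1 hx)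
    exact hfinal (Finsupp.mem_support_iff.2 hμ) (Finsupp.mem_support_iff.2 hx)
  · simpa using P.weak_isConvexRel.iConvexComb (f := id)
      fun μ hμ => hweak (Finsupp.mem_support_iff.2 hμ)

/-! ### Simulation relations -/

/-- The conditions (2) and (3) of a simulation, which do not involve the initial distributions. -/
structure IsSimRel (P Q : PAut.{u} I E) (S : P.State → FinDist Q.State → Prop) : Prop where
  step : ∀ x a μ ν, P.trans x a μ → S x ν → ∃ ν', Q.WeakStep a ν ν' ∧ Lift S μ ν'
  final : ∀ x ν, x ∈ P.final → S x ν → Q.CanTerminate ν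

namespace IsSimRel

variable {S : P.State → FinDist Q.State → Prop} {μ μ' : FinDist P.State} {ν : FinDist Q.State}

theorem lift_step (hS : IsSimRel P Q S) (h : Lift S μ ν) (hstep : Lift (P.Step a) μ μ') :
    ∃ ν', Q.WeakStep a ν ν' ∧ Lift S μ' ν' := by
  have convex : IsConvexRel (Relation.Comp (Q.WeakStep a) (flip (Lift S))) :=
    (Q.weakStep_isConvexRel a).comp (Lift.isConvexRel S).flip
  refine h.rel_of_rel₂ hstep convex fun x ν μ' hx hμ' => ?_
  obtain hμ' | ⟨rfl, rfl⟩ := hμ'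
  · exact hS.step x a μ' ν hμ' hx
  · exact ⟨ν, weakStep_tau_iff.2 (.refl ν), .of_rel hx⟩

theorem lift_weak (hS : IsSimRel P Q S) (h : Lift S μ ν) (hweak : P.Weak μ μ') :
    ∃ ν', Q.Weak ν ν' ∧ Lift S μ' ν' := by
  induction hweak with
  | refl => exact ⟨ν, .refl ν, h⟩
  | tail _ hstep ih =>
    obtain ⟨ν₁, hν₁, h₁⟩ := ih
    obtain ⟨ν₂, hν₂, h₂⟩ := hS.lift_step h₁ hstep
    exact ⟨ν₂, hν₁.trans (weakStep_tau_iff.1 hν₂), h₂⟩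

theorem lift_weakStep (hS : IsSimRel P Q S) (h : Lift S μ ν) (hweak : P.WeakStep a μ μ') :
    ∃ ν', Q.WeakStep a ν ν' ∧ Lift S μ' ν' := by
  obtain ⟨μ₁, μ₂, hμ₁, hμ₂, hμ'⟩ := hweak
  obtain ⟨ν₁, hν₁, h₁⟩ := hS.lift_weak h hμ₁
  obtain ⟨ν₂, hν₂, h₂⟩ := hS.lift_step h₁ hμ₂
  obtain ⟨ν', hν', h'⟩ := hS.lift_weak h₂ hμ'
  exact ⟨ν', hν₁.trans_weakStep (hν₂.trans_weak hν'), h'⟩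

theorem canTerminate (hS : IsSimRel P Q S) (h : Lift S μ ν) (hμ : P.CanTerminate μ) :
    Q.CanTerminate ν := by
  obtain ⟨μ', hfinal, hweak⟩ := hμ
  obtain ⟨ν', hν', h'⟩ := hS.lift_weak h hweak
  obtain ⟨g, hg, rfl⟩ := lift_iff_exists_kernel.1 h'
  refine .of_weak hν' (Q.isConvexSet_canTerminate.iConvexComb_mem fun x hx => ?_)
  exact Convexity.convexHull_min (hS.final x · (hfinal (Finsupp.mem_support_iff.2 hx)))
    Q.isConvexSet_canTerminate (hg x hx)

theorem comp {S' : Q.State → FinDist R.State → Prop} (hS : IsSimRel P Q S)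
    (hS' : IsSimRel Q R S') : IsSimRel P R fun x ξ => ∃ ν, S x ν ∧ Lift S' ν ξ where
  step := by
    rintro x a μ ξ hμ ⟨ν, hν, hξ⟩
    obtain ⟨ν', hν', h⟩ := hS.step x a μ ν hμ hν
    obtain ⟨ξ', hξ', h'⟩ := hS'.lift_weakStep hξ hν'
    exact ⟨ξ', hξ', h.comp h'⟩
  final := by
    rintro x ξ hx ⟨ν, hν, hξ⟩
    exact hS'.canTerminate hξ (hS.final x ν hx hν)

end IsSimRel

/-- The greatest simulation relation from the states of `P` to the distributions of `Q`. -/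
def Similar (P Q : PAut.{u} I E) (x : P.State) (ν : FinDist Q.State) : Prop :=
  ∃ S, IsSimRel P Q S ∧ S x ν

theorem IsSimRel.lift_similar {S : P.State → FinDist Q.State → Prop} (hS : IsSimRel P Q S)
    {μ : FinDist P.State} {ν : FinDist Q.State} (h : Lift S μ ν) : Lift (Similar P Q) μ ν :=
  h.mono fun _ _ hx => ⟨S, hS, hx⟩

theorem isSimRel_similar (P Q : PAut.{u} I E) : IsSimRel P Q (Similar P Q) where
  step := by
    rintro x a μ ν hμ ⟨S, hS, hx⟩
    obtain ⟨ν', hν', h⟩ := hS.step x a μ ν hμ hx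
    exact ⟨ν', hν', hS.lift_similar h⟩
  final := fun x ν hx ⟨_, hS, h⟩ => hS.final x ν hx h

/-- `Similar` extended to distributions: `ν` simulates `μ`, possibly after some silent steps.
`P ≤ Q` says that this holds for the initial distributions. -/
def DistSimilar (P Q : PAut.{u} I E) (μ : FinDist P.State) (ν : FinDist Q.State) : Prop :=
  ∃ ν', Q.Weak ν ν' ∧ Lift (Similar P Q) μ ν'

theorem simLE_iff_distSimilar : P.SimLE Q ↔ DistSimilar P Q P.init Q.init := by
  constructor
  · rintro ⟨S, ⟨ν, hν, hweak⟩, hstep, hfinal⟩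
    exact ⟨ν, hweak, (IsSimRel.mk hstep hfinal).lift_similar hν⟩
  · rintro ⟨ν, hweak, hν⟩
    have := isSimRel_similar P Q
    exact ⟨Similar P Q, ⟨ν, hν, hweak⟩, this.step, this.final⟩

namespace DistSimilar

variable {μ μ' : FinDist P.State} {ν ν' : FinDist Q.State}

theorem of_weak (hν : Q.Weak ν ν') (h : DistSimilar P Q μ ν') : DistSimilar P Q μ ν :=
  let ⟨_, hweak, h'⟩ := h
  ⟨_, hν.trans hweak, h'⟩

protected theorem trans {ξ : FinDist R.State} (h : DistSimilar P Q μ ν)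
    (h' : DistSimilar Q R ν ξ) : DistSimilar P R μ ξ := by
  obtain ⟨ν', hν', h⟩ := h
  obtain ⟨ξ₁, hξ₁, h'⟩ := h'
  obtain ⟨ξ₂, hξ₂, h₂⟩ := (isSimRel_similar Q R).lift_weak h' hν'
  exact ⟨ξ₂, hξ₁.trans hξ₂,
    ((isSimRel_similar P Q).comp (isSimRel_similar Q R)).lift_similar (h.comp h₂)⟩

protected theorem mix (p : unitInterval) (h : DistSimilar P Q μ ν) (h' : DistSimilar P Q μ' ν') :
    DistSimilar P Q (mix p μ μ') (mix p ν ν') :=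
  let ⟨_, hweak, hlift⟩ := h
  let ⟨_, hweak', hlift'⟩ := h'
  ⟨_, Q.weak_isConvexRel.mix p hweak hweak', (Lift.isConvexRel _).mix p hlift hlift'⟩

end DistSimilar

/-- A map on states that turns transitions into weak transitions with the same label; its graph is
a simulation relation. -/
structure IsSimMap (P Q : PAut.{u} I E) (f : P.State → Q.State) : Prop where
  step : ∀ x a μ, P.trans x a μ → Q.WeakStep a (dirac (f x)) (μ.map f)
  final : ∀ x ∈ P.final, Q.CanTerminate (dirac (f x))

namespace IsSimMap

variable {f : P.State → Q.State}

theorem of_trans (step : ∀ x a μ, P.trans x a μ → Q.trans (f x) a (μ.map f))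
    (final : ∀ x ∈ P.final, f x ∈ Q.final) : IsSimMap P Q f where
  step x a μ h := .of_trans (step x a μ h)
  final x hx := canTerminate_dirac (final x hx)

theorem lift_similar (hf : IsSimMap P Q f) (μ : FinDist P.State) :
    Lift (Similar P Q) μ (μ.map f) := by
  have lift_graph (μ : FinDist P.State) : Lift (fun x ν => ν = dirac (f x)) μ (μ.map f) := by
    simpa using Lift.of_forall_rel μ (S := fun x ν => ν = dirac (f x)) fun _ => rfl
  refine IsSimRel.lift_similar ⟨?_, ?_⟩ (lift_graph μ)
  · rintro x a μ _ hμ rfl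
    exact ⟨_, hf.step x a μ hμ, lift_graph μ⟩
  · rintro x _ hx rfl
    exact hf.final x hx

theorem distSimilar (hf : IsSimMap P Q f) (μ : FinDist P.State) :
    DistSimilar P Q μ (μ.map f) :=
  ⟨_, .refl _, hf.lift_similar μ⟩

theorem simLE (hf : IsSimMap P Q f) (hinit : Q.Weak Q.init (P.init.map f)) : P.SimLE Q :=
  simLE_iff_distSimilar.2 (.of_weak hinit (hf.distSimilar _))

end IsSimMap

theorem DistSimilar.refl (μ : FinDist P.State) : DistSimilar P P μ μ := by
  simpa using (IsSimMap.of_trans (f := id) (by simp) (by simp)).distSimilar μ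

theorem SimLE.refl (P : PAut.{u} I E) : P.SimLE P :=
  simLE_iff_distSimilar.2 (.refl _)

theorem SimLE.trans (hPQ : P.SimLE Q) (hQR : Q.SimLE R) : P.SimLE R :=
  simLE_iff_distSimilar.2 ((simLE_iff_distSimilar.1 hPQ).trans (simLE_iff_distSimilar.1 hQR))

/-! ### Nondeterministic choice -/

section Trans

-- The constructors mention `P` and `Q` only through their states and transitions; stated for the
-- automata, they let unification find the automaton in which a weak transition takes place.

variable {x : P.State} {y : Q.State} {μ : FinDist P.State} {ν : FinDist Q.State}

theorem add_trans_left (hx : P.trans x a μ) (Q : PAut.{u} I E) :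
    (P.add Q).trans (some (Sum.inl x)) a (μ.map fun s => some (Sum.inl s)) :=
  .left hx

theorem add_trans_right (P : PAut.{u} I E) (hy : Q.trans y a ν) :
    (P.add Q).trans (some (Sum.inr y)) a (ν.map fun s => some (Sum.inr s)) :=
  .right hy

theorem add_trans_startLeft (P Q : PAut.{u} I E) :
    (P.add Q).trans none Act.tau (P.init.map fun s => some (Sum.inl s)) :=
  .startLeft

theorem add_trans_startRight (P Q : PAut.{u} I E) :
    (P.add Q).trans none Act.tau (Q.init.map fun s => some (Sum.inr s)) :=
  .startRight

theorem seq_trans_inl (hx : P.trans x a μ) (Q : PAut.{u} I E) :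
    (P.seq Q).trans (Sum.inl x) a (μ.map Sum.inl) :=
  .left hx

theorem seq_trans_inr (P : PAut.{u} I E) (hy : Q.trans y a ν) :
    (P.seq Q).trans (Sum.inr y) a (ν.map Sum.inr) :=
  .right hy

theorem seq_trans_pass (hx : x ∈ P.final) (Q : PAut.{u} I E) :
    (P.seq Q).trans (Sum.inl x) Act.tau (Q.init.map Sum.inr) :=
  .pass hx

theorem star_trans_some (hx : P.trans x a μ) : P.star.trans (some x) a (μ.map some) :=
  .inner hx

theorem star_trans_none (P : PAut.{u} I E) : P.star.trans none Act.tau (P.init.map some) :=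
  .start

theorem star_trans_back (hx : x ∈ P.final) : P.star.trans (some x) Act.tau (dirac none) :=
  .back hx

end Trans

theorem isSimMap_add_left (P Q : PAut.{u} I E) :
    IsSimMap P (P.add Q) fun x => some (Sum.inl x) :=
  .of_trans (fun _ _ _ hx => add_trans_left hx Q) fun x hx => .inl ⟨x, hx, rfl⟩

theorem isSimMap_add_right (P Q : PAut.{u} I E) :
    IsSimMap Q (P.add Q) fun y => some (Sum.inr y) :=
  .of_trans (fun _ _ _ => add_trans_right P) fun y hy => .inr ⟨y, hy, rfl⟩

theorem le_add_left (P Q : PAut.{u} I E) : P.SimLE (P.add Q) :=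
  (isSimMap_add_left P Q).simLE (.of_trans (add_trans_startLeft P Q))

theorem le_add_right (P Q : PAut.{u} I E) : Q.SimLE (P.add Q) :=
  (isSimMap_add_right P Q).simLE (.of_trans (add_trans_startRight P Q))

theorem add_le (hP : P.SimLE R) (hQ : Q.SimLE R) : (P.add Q).SimLE R := by
  obtain ⟨ν, hν, h⟩ := simLE_iff_distSimilar.1 hP
  obtain ⟨ν', hν', h'⟩ := simLE_iff_distSimilar.1 hQ
  refine ⟨fun s ξ => s.elim (ξ = R.init) (Sum.elim (Similar P R · ξ) (Similar Q R · ξ)),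
    ⟨R.init, .of_rel rfl, .refl _⟩, ?_, ?_⟩
  · rintro _ a _ ξ (hx | hy | _ | _) hξ
    · obtain ⟨ξ', hξ', h⟩ := (isSimRel_similar P R).step _ _ _ _ hx hξ
      exact ⟨ξ', hξ', lift_map_left_iff.2 h⟩
    · obtain ⟨ξ', hξ', h⟩ := (isSimRel_similar Q R).step _ _ _ _ hy hξ
      exact ⟨ξ', hξ', lift_map_left_iff.2 h⟩
    · obtain rfl : ξ = R.init := hξ
      exact ⟨ν, weakStep_tau_iff.2 hν, lift_map_left_iff.2 h⟩
    · obtain rfl : ξ = R.init := hξ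
      exact ⟨ν', weakStep_tau_iff.2 hν', lift_map_left_iff.2 h'⟩
  · rintro _ ξ (⟨x, hx, rfl⟩ | ⟨y, hy, rfl⟩) hξ
    · exact (isSimRel_similar P R).final x ξ hx hξ
    · exact (isSimRel_similar Q R).final y ξ hy hξ

theorem add_mono (hP : P.SimLE P') (hQ : Q.SimLE Q') : (P.add Q).SimLE (P'.add Q') :=
  add_le (hP.trans (le_add_left P' Q')) (hQ.trans (le_add_right P' Q'))

theorem deadlock_le (P : PAut.{u} I E) : deadlock.SimLE P :=
  ⟨fun _ _ => True, ⟨P.init, .of_rel trivial, .refl _⟩, fun _ _ _ _ => False.elim,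
    fun _ _ => False.elim⟩

theorem add_equiv_right_iff : (P.add Q).SimEquiv Q ↔ P.SimLE Q :=
  ⟨fun h => (le_add_left P Q).trans h.1, fun h => ⟨add_le h (.refl Q), le_add_right P Q⟩⟩

theorem add_self_equiv (P : PAut.{u} I E) : P.SimEquiv (P.add P) :=
  ⟨le_add_left P P, add_le (.refl P) (.refl P)⟩

theorem add_deadlock_equiv (P : PAut.{u} I E) : P.SimEquiv (P.add deadlock) :=
  ⟨le_add_left P deadlock, add_le (.refl P) (deadlock_le P)⟩

theorem add_comm_equiv (P Q : PAut.{u} I E) : (P.add Q).SimEquiv (Q.add P) :=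
  ⟨add_le (le_add_right Q P) (le_add_left Q P), add_le (le_add_right P Q) (le_add_left P Q)⟩

theorem add_assoc_equiv (P Q R : PAut.{u} I E) :
    (P.add (Q.add R)).SimEquiv ((P.add Q).add R) :=
  ⟨add_le ((le_add_left P Q).trans (le_add_left _ R)) (add_mono (le_add_right P Q) (.refl R)),
    add_le (add_mono (.refl P) (le_add_left Q R)) ((le_add_right Q R).trans (le_add_right P _))⟩

/-! ### Sequential composition -/

theorem isSimMap_seq_inr (P Q : PAut.{u} I E) : IsSimMap Q (P.seq Q) Sum.inr :=
  .of_trans (fun _ _ _ => seq_trans_inr P) fun _ => Set.mem_image_of_mem _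

theorem CanTerminate.weak_seq {μ : FinDist P.State} (h : P.CanTerminate μ) (Q : PAut.{u} I E) :
    (P.seq Q).Weak (μ.map Sum.inl) (Q.init.map Sum.inr) := by
  obtain ⟨μ', hfinal, hweak⟩ := h
  have pass : (P.seq Q).Weak (μ'.map Sum.inl) (Q.init.map Sum.inr) :=
    weak_map_of_forall_weak_dirac fun x hx =>
      .of_trans (seq_trans_pass (hfinal (Finsupp.mem_support_iff.2 hx)) Q)
  exact (hweak.map fun _ _ => SeqTrans.left).trans pass

theorem seq_le {S : P.State → FinDist R.State → Prop}
    (init : ∃ ν, Lift S P.init ν ∧ R.Weak R.init ν)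
    (step : ∀ x a μ ν, P.trans x a μ → S x ν → ∃ ν', R.WeakStep a ν ν' ∧ Lift S μ ν')
    (final : ∀ x ν, x ∈ P.final → S x ν → DistSimilar Q R Q.init ν) : (P.seq Q).SimLE R := by
  obtain ⟨ν, hν, hweak⟩ := init
  refine ⟨fun s ξ => Sum.elim (S · ξ) (Similar Q R · ξ) s,
    ⟨ν, lift_map_left_iff.2 hν, hweak⟩, ?_, ?_⟩
  · rintro _ a _ ξ (hx | hy | hx) hξ
    · obtain ⟨ξ', hξ', h⟩ := step _ _ _ _ hx hξ
      exact ⟨ξ', hξ', lift_map_left_iff.2 h⟩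
    · obtain ⟨ξ', hξ', h⟩ := (isSimRel_similar Q R).step _ _ _ _ hy hξ
      exact ⟨ξ', hξ', lift_map_left_iff.2 h⟩
    · obtain ⟨ξ', hξ', h⟩ := final _ _ hx hξ
      exact ⟨ξ', weakStep_tau_iff.2 hξ', lift_map_left_iff.2 h⟩
  · rintro _ ξ ⟨y, hy, rfl⟩ hξ
    exact (isSimRel_similar Q R).final y ξ hy hξ

theorem seq_le_of_kernel (κ : P.State → FinDist R.State)
    (init : R.Weak R.init (P.init.iConvexComb κ))
    (step : ∀ x a μ, P.trans x a μ → R.WeakStep a (κ x) (μ.iConvexComb κ))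
    (final : ∀ x ∈ P.final, DistSimilar Q R Q.init (κ x)) : (P.seq Q).SimLE R := by
  have lift_graph (μ : FinDist P.State) : Lift (fun x ν => ν = κ x) μ (μ.iConvexComb κ) :=
    .of_forall_rel μ fun _ => rfl
  refine seq_le ⟨_, lift_graph _, init⟩ ?_ ?_
  · rintro x a μ _ hμ rfl
    exact ⟨_, step x a μ hμ, lift_graph μ⟩
  · rintro x _ hx rfl
    exact final x hx

theorem seq_le_of_map (f : P.State → R.State) (init : R.Weak R.init (P.init.map f))
    (step : ∀ x a μ, P.trans x a μ → R.WeakStep a (dirac (f x)) (μ.map f))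
    (final : ∀ x ∈ P.final, DistSimilar Q R Q.init (dirac (f x))) : (P.seq Q).SimLE R :=
  seq_le_of_kernel (fun x => dirac (f x)) (by simpa using init) (by simpa using step) final

theorem seq_mono (hP : P.SimLE P') (hQ : Q.SimLE Q') : (P.seq Q).SimLE (P'.seq Q') := by
  obtain ⟨ν, hν, h⟩ := simLE_iff_distSimilar.1 hP
  refine seq_le (S := fun x ξ => ∃ ν, Similar P P' x ν ∧ ξ = ν.map Sum.inl)
    ⟨_, h.map_right _, hν.map fun _ _ => SeqTrans.left⟩ ?_ ?_
  · rintro x a μ _ hμ ⟨ν, hx, rfl⟩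
    obtain ⟨ν', hν', h⟩ := (isSimRel_similar P P').step x a μ ν hμ hx
    exact ⟨_, hν'.map (fun _ _ => SeqTrans.left) fun _ _ => SeqTrans.left, h.map_right _⟩
  · rintro x _ hx ⟨ν, hν, rfl⟩
    exact .of_weak (((isSimRel_similar P P').final x ν hx hν).weak_seq Q')
      ((simLE_iff_distSimilar.1 hQ).trans ((isSimMap_seq_inr P' Q').distSimilar _))

theorem IsSimMap.seq {f : P.State → P'.State} (hf : IsSimMap P P' f) (Q : PAut.{u} I E) :
    IsSimMap (P.seq Q) (P'.seq Q) (Sum.map f id) where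
  step := by
    rintro _ a _ (hx | hy | hx)
    · simpa [PAut.seq] using (hf.step _ _ _ hx).map (Q := P'.seq Q) (fun _ _ => SeqTrans.left)
        fun _ _ => SeqTrans.left
    · simpa [PAut.seq] using WeakStep.of_trans (seq_trans_inr P' hy)
    · simpa [PAut.seq] using weakStep_tau_iff.2 ((hf.final _ hx).weak_seq Q)
  final := by
    rintro _ ⟨y, hy, rfl⟩
    exact (isSimMap_seq_inr P' Q).final y hy

theorem distSimilar_skip {ν : FinDist P.State} (h : P.CanTerminate ν) :
    DistSimilar skip P skip.init ν :=
  have : IsSimRel skip P fun _ => P.CanTerminate := ⟨nofun, fun _ _ _ => id⟩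
  ⟨ν, .refl ν, this.lift_similar (.of_rel h)⟩

theorem seq_skip_equiv (P : PAut.{u} I E) : P.SimEquiv (P.seq skip) := by
  constructor
  · refine IsSimMap.simLE ⟨fun x a μ hx => .of_trans (seq_trans_inl hx skip), fun x hx => ?_⟩
      (.refl _)
    have lift_init := (isSimMap_seq_inr P skip).lift_similar skip.init
    exact .of_weak (.of_trans (seq_trans_pass hx skip))
      ((isSimRel_similar _ _).canTerminate lift_init (canTerminate_dirac trivial))
  · exact seq_le_of_map id (by simpa using .refl _) (fun x a μ h => by simpa using .of_trans h)
      fun x hx => distSimilar_skip (canTerminate_dirac hx)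

theorem skip_seq_equiv (P : PAut.{u} I E) : P.SimEquiv (skip.seq P) := by
  constructor
  · refine (isSimMap_seq_inr skip P).simLE ?_
    simpa [seq, skip] using
      Weak.of_trans (seq_trans_pass (P := skip) (Set.mem_univ PUnit.unit) P)
  · exact seq_le_of_kernel (fun _ => P.init) (by simpa using .refl _) nofun fun _ _ => .refl _

theorem deadlock_seq_equiv (P : PAut.{u} I E) : deadlock.SimEquiv (deadlock.seq P) :=
  ⟨deadlock_le _, seq_le_of_map id (by simpa using .refl _) nofun nofun⟩

theorem seq_assoc_equiv (P Q R : PAut.{u} I E) :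
    (P.seq (Q.seq R)).SimEquiv ((P.seq Q).seq R) := by
  constructor
  · refine IsSimMap.simLE (f := (Equiv.sumAssoc _ _ _).symm) (.of_trans ?_ ?_)
      (by simpa [seq] using .refl _)
    · rintro _ a _ (hx | (hy | hz | hy) | hx)
      · simpa [seq] using seq_trans_inl (seq_trans_inl hx Q) R
      · simpa [seq] using seq_trans_inl (seq_trans_inr P hy) R
      · simpa [seq] using seq_trans_inr (P.seq Q) hz
      · simpa [seq] using seq_trans_pass (P := P.seq Q) ⟨_, hy, rfl⟩ R
      · simpa [seq] using seq_trans_inl (seq_trans_pass hx Q) R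
    · rintro _ ⟨_, ⟨z, hz, rfl⟩, rfl⟩
      exact ⟨z, hz, rfl⟩
  · refine IsSimMap.simLE (f := Equiv.sumAssoc _ _ _) (.of_trans ?_ ?_)
      (by simpa [seq] using .refl _)
    · rintro _ a _ ((hx | hy | hx) | hz | ⟨y, hy, rfl⟩)
      · simpa [seq] using seq_trans_inl hx (Q.seq R)
      · simpa [seq] using seq_trans_inr P (seq_trans_inl hy R)
      · simpa [seq] using seq_trans_pass hx (Q.seq R)
      · simpa [seq] using seq_trans_inr P (seq_trans_inr Q hz)
      · simpa [seq] using seq_trans_inr P (seq_trans_pass hy R)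
    · rintro _ ⟨z, hz, rfl⟩
      exact ⟨_, ⟨z, hz, rfl⟩, rfl⟩

theorem seq_add_seq_le (P Q R : PAut.{u} I E) :
    ((P.seq Q).add (P.seq R)).SimLE (P.seq (Q.add R)) :=
  add_le (seq_mono (.refl P) (le_add_left Q R)) (seq_mono (.refl P) (le_add_right Q R))

theorem add_seq_equiv (P Q R : PAut.{u} I E) :
    ((P.seq R).add (Q.seq R)).SimEquiv ((P.add Q).seq R) := by
  refine ⟨add_le (seq_mono (le_add_left P Q) (.refl R)) (seq_mono (le_add_right P Q) (.refl R)),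
    seq_le_of_map (Option.map (Sum.map Sum.inl Sum.inl)) ?_ ?_ ?_⟩
  · simpa [add] using .refl _
  · rintro _ a _ (hx | hy | _ | _)
    · simpa [add, seq] using WeakStep.of_trans (add_trans_left (seq_trans_inl hx R) (Q.seq R))
    · simpa [add, seq] using WeakStep.of_trans (add_trans_right (P.seq R) (seq_trans_inl hy R))
    · simpa [add, seq] using WeakStep.of_trans (add_trans_startLeft (P.seq R) (Q.seq R))
    · simpa [add, seq] using WeakStep.of_trans (add_trans_startRight (P.seq R) (Q.seq R))
  · rintro _ (⟨x, hx, rfl⟩ | ⟨y, hy, rfl⟩)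
    · exact .of_weak (.of_trans (add_trans_left (seq_trans_pass hx R) (Q.seq R))) <|
        ((isSimMap_seq_inr P R).distSimilar _).trans ((isSimMap_add_left _ _).distSimilar _)
    · exact .of_weak (.of_trans (add_trans_right (P.seq R) (seq_trans_pass hy R))) <|
        ((isSimMap_seq_inr Q R).distSimilar _).trans ((isSimMap_add_right _ _).distSimilar _)

/-! ### Kleene star -/

theorem skip_le_star (P : PAut.{u} I E) : skip.SimLE P.star :=
  (IsSimMap.of_trans (f := fun _ => none) (fun _ _ _ => False.elim) fun _ _ => rfl).simLE
    (by simpa [skip, star] using .refl _)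

theorem seq_star_le_star (P : PAut.{u} I E) : (P.seq P.star).SimLE P.star :=
  seq_le_of_map some (.of_trans (star_trans_none P))
    (fun _ _ _ hx => .of_trans (star_trans_some hx)) fun _ hx =>
    .of_weak (.of_trans (star_trans_back hx)) (.refl _)

theorem star_seq_le (h : (P.seq Q).SimLE Q) : (P.star.seq Q).SimLE Q := by
  rw [simLE_iff_distSimilar] at h
  let S (s : P.star.State) (ν : FinDist Q.State) : Prop :=
    s.elim (DistSimilar Q Q Q.init ν) fun x => Similar (P.seq Q) Q (Sum.inl x) ν
  refine seq_le (S := S) ⟨Q.init, .of_rel (.refl _), .refl _⟩ ?_ ?_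
  · rintro _ a _ ν (hx | _ | hx) hν
    · obtain ⟨ν', hν', h⟩ := (isSimRel_similar (P.seq Q) Q).step _ _ _ _ (.left hx) hν
      exact ⟨ν', hν', lift_map_left_iff.2 ((lift_map_left_iff (f := Sum.inl)).1 h)⟩
    · obtain ⟨ν', hν', h⟩ := h.trans hν
      exact ⟨ν', weakStep_tau_iff.2 hν',
        lift_map_left_iff.2 ((lift_map_left_iff (f := Sum.inl)).1 h)⟩
    · obtain ⟨ν', hν', h⟩ := (isSimRel_similar (P.seq Q) Q).step _ _ _ _ (.pass hx) hν
      exact ⟨ν', hν', .of_rel (((isSimMap_seq_inr P Q).distSimilar _).trans ⟨ν', .refl _, h⟩)⟩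
  · rintro _ ν rfl hν
    exact hν

theorem star_le (h₁ : skip.SimLE Q) (h₂ : (P.seq Q).SimLE Q) : P.star.SimLE Q :=
  (seq_skip_equiv _).1.trans ((seq_mono (.refl _) h₁).trans (star_seq_le h₂))

theorem star_mono (h : P.SimLE Q) : P.star.SimLE Q.star :=
  star_le (skip_le_star Q) ((seq_mono h (.refl _)).trans (seq_star_le_star Q))

theorem star_unfold_equiv (P : PAut.{u} I E) : P.star.SimEquiv (skip.add (P.seq P.star)) := by
  have unfold_le : (skip.add (P.seq P.star)).SimLE P.star :=
    add_le (skip_le_star P) (seq_star_le_star P)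
  exact ⟨star_le (le_add_left _ _) ((seq_mono (.refl P) unfold_le).trans (le_add_right _ _)),
    unfold_le⟩

/-! ### Probabilistic choice -/

section Choice

variable (p : unitInterval)

theorem choice_trans_inl {x : P.State} {μ : FinDist P.State} (hx : P.trans x a μ)
    (Q : PAut.{u} I E) : (choice p P Q).trans (Sum.inl x) a (μ.map Sum.inl) :=
  .left hx

theorem choice_trans_inr (P : PAut.{u} I E) {y : Q.State} {ν : FinDist Q.State}
    (hy : Q.trans y a ν) : (choice p P Q).trans (Sum.inr y) a (ν.map Sum.inr) :=
  .right hy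

theorem isSimMap_choice_inl (P Q : PAut.{u} I E) : IsSimMap P (choice p P Q) Sum.inl :=
  .of_trans (fun _ _ _ hx => choice_trans_inl p hx Q) fun _ hx => .inl (Set.mem_image_of_mem _ hx)

theorem isSimMap_choice_inr (P Q : PAut.{u} I E) : IsSimMap Q (choice p P Q) Sum.inr :=
  .of_trans (fun _ _ _ => choice_trans_inr p P) fun _ hy => .inr (Set.mem_image_of_mem _ hy)

theorem distSimilar_choice {ν ν' : FinDist R.State} (hP : DistSimilar P R P.init ν)
    (hQ : DistSimilar Q R Q.init ν') :
    DistSimilar (choice p P Q) R (choice p P Q).init (mix p ν ν') := by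
  have sim : IsSimRel (choice p P Q) R fun s ξ =>
      Sum.elim (Similar P R · ξ) (Similar Q R · ξ) s := by
    refine ⟨?_, ?_⟩
    · rintro _ a _ ξ (hx | hy) hξ
      · obtain ⟨ξ', hξ', h⟩ := (isSimRel_similar P R).step _ _ _ _ hx hξ
        exact ⟨ξ', hξ', lift_map_left_iff.2 h⟩
      · obtain ⟨ξ', hξ', h⟩ := (isSimRel_similar Q R).step _ _ _ _ hy hξ
        exact ⟨ξ', hξ', lift_map_left_iff.2 h⟩
    · rintro _ ξ (⟨x, hx, rfl⟩ | ⟨y, hy, rfl⟩) hξ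
      · exact (isSimRel_similar P R).final x ξ hx hξ
      · exact (isSimRel_similar Q R).final y ξ hy hξ
  obtain ⟨ξ, hξ, h⟩ := hP
  obtain ⟨ξ', hξ', h'⟩ := hQ
  exact ⟨_, R.weak_isConvexRel.mix p hξ hξ', sim.lift_similar
    ((Lift.isConvexRel _).mix p (lift_map_left_iff.2 h) (lift_map_left_iff.2 h'))⟩

theorem choice_le {ν ν' : FinDist R.State} (hinit : R.init = mix p ν ν')
    (hP : DistSimilar P R P.init ν) (hQ : DistSimilar Q R Q.init ν') : (choice p P Q).SimLE R :=
  simLE_iff_distSimilar.2 (hinit ▸ distSimilar_choice p hP hQ)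

theorem choice_mono (hP : P.SimLE P') (hQ : Q.SimLE Q') :
    (choice p P Q).SimLE (choice p P' Q') :=
  choice_le p rfl
    ((simLE_iff_distSimilar.1 hP).trans ((isSimMap_choice_inl p P' Q').distSimilar _))
    ((simLE_iff_distSimilar.1 hQ).trans ((isSimMap_choice_inr p P' Q').distSimilar _))

theorem choice_self_equiv (P : PAut.{u} I E) : P.SimEquiv (choice p P P) := by
  constructor
  · have := ((isSimMap_choice_inl p P P).distSimilar P.init).mix p
      ((isSimMap_choice_inr p P P).distSimilar P.init)
    rw [mix_self] at this
    exact simLE_iff_distSimilar.2 this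
  · exact choice_le p (mix_self p _).symm (.refl _) (.refl _)

theorem choice_comm_equiv (P Q : PAut.{u} I E) :
    (choice p P Q).SimEquiv (choice (unitInterval.symm p) Q P) :=
  ⟨choice_le p (mix_symm ..) ((isSimMap_choice_inr _ Q P).distSimilar _)
      ((isSimMap_choice_inl _ Q P).distSimilar _),
    choice_le _ (mix_symm ..).symm ((isSimMap_choice_inr p P Q).distSimilar _)
      ((isSimMap_choice_inl p P Q).distSimilar _)⟩

theorem choice_seq_equiv (P Q R : PAut.{u} I E) :
    ((choice p P Q).seq R).SimEquiv (choice p (P.seq R) (Q.seq R)) := by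
  constructor
  · refine seq_le_of_map (Sum.map Sum.inl Sum.inl) (by simpa [choice, seq] using .refl _) ?_ ?_
    · rintro _ a _ (hx | hy)
      · simpa [choice, seq] using
          WeakStep.of_trans (choice_trans_inl p (seq_trans_inl hx R) (Q.seq R))
      · simpa [choice, seq] using
          WeakStep.of_trans (choice_trans_inr p (P.seq R) (seq_trans_inl hy R))
    · rintro _ (⟨x, hx, rfl⟩ | ⟨y, hy, rfl⟩)
      · exact .of_weak (.of_trans (choice_trans_inl p (seq_trans_pass hx R) (Q.seq R))) <|
          ((isSimMap_seq_inr P R).distSimilar _).trans ((isSimMap_choice_inl ..).distSimilar _)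
      · exact .of_weak (.of_trans (choice_trans_inr p (P.seq R) (seq_trans_pass hy R))) <|
          ((isSimMap_seq_inr Q R).distSimilar _).trans ((isSimMap_choice_inr ..).distSimilar _)
  · exact choice_le p (by simp [choice, seq])
      (((isSimMap_choice_inl p P Q).seq R).distSimilar _)
      (((isSimMap_choice_inr p P Q).seq R).distSimilar _)

theorem seq_choice_le (P Q R : PAut.{u} I E) :
    (P.seq (choice p Q R)).SimLE (choice p (P.seq Q) (P.seq R)) := by
  let T := choice p (P.seq Q) (P.seq R)
  let inQ (x : P.State) : T.State := Sum.inl (Sum.inl x)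
  let inR (x : P.State) : T.State := Sum.inr (Sum.inl x)
  refine seq_le_of_kernel (R := T) (fun x => mix p (dirac (inQ x)) (dirac (inR x))) ?_ ?_ ?_
  · rw [iConvexComb_mix_dirac]
    simpa [T, inQ, inR, choice, seq] using .refl _
  · intro x a μ hx
    rw [iConvexComb_mix_dirac]
    refine (T.weakStep_isConvexRel a).mix p ?_ ?_
    · simpa [T, inQ, choice, seq] using
        WeakStep.of_trans (choice_trans_inl p (seq_trans_inl hx Q) (P.seq R))
    · simpa [T, inR, choice, seq] using
        WeakStep.of_trans (choice_trans_inr p (P.seq Q) (seq_trans_inl hx R))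
  · intro x hx
    refine distSimilar_choice p ?_ ?_
    · exact .of_weak (.of_trans (choice_trans_inl p (seq_trans_pass hx Q) (P.seq R))) <|
        ((isSimMap_seq_inr P Q).distSimilar _).trans ((isSimMap_choice_inl ..).distSimilar _)
    · exact .of_weak (.of_trans (choice_trans_inr p (P.seq Q) (seq_trans_pass hx R))) <|
        ((isSimMap_seq_inr P R).distSimilar _).trans ((isSimMap_choice_inr ..).distSimilar _)

end Choice

theorem choice_assoc_equiv {p q p' q' : unitInterval} (h₁ : (p' * q' : ℝ) = p)
    (h₂ : ((1 - p') * q' : ℝ) = (1 - p) * q) (h₃ : (1 - q' : ℝ) = (1 - p) * (1 - q))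
    (P Q R : PAut.{u} I E) :
    (choice p P (choice q Q R)).SimEquiv (choice q' (choice p' P Q) R) := by
  constructor
  · have inl := isSimMap_choice_inl q' (choice p' P Q) R
    refine choice_le p ?_
      (((isSimMap_choice_inl p' P Q).distSimilar _).trans (inl.distSimilar _))
      (distSimilar_choice q
        (((isSimMap_choice_inr p' P Q).distSimilar _).trans (inl.distSimilar _))
        ((isSimMap_choice_inr q' (choice p' P Q) R).distSimilar _))
    simp [choice, mix_assoc h₁ h₂ h₃]
  · have inr := isSimMap_choice_inr p P (choice q Q R)
    refine choice_le q' ?_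
      (distSimilar_choice p' ((isSimMap_choice_inl p P (choice q Q R)).distSimilar _)
        (((isSimMap_choice_inl q Q R).distSimilar _).trans (inr.distSimilar _)))
      (((isSimMap_choice_inr q Q R).distSimilar _).trans (inr.distSimilar _))
    simp [choice, mix_assoc h₁ h₂ h₃]

/-! ### Parallel composition -/

section Par

variable {A : Set E}

theorem tau_notMem_external (A : Set E) : (Act.tau : Act I E) ∉ Act.external '' A := by
  simp

theorem par_trans_sync (ha : a ∈ Act.external '' A) {x : P.State} {y : Q.State}
    {μ : FinDist P.State} {ν : FinDist Q.State} (hx : P.trans x a μ) (hy : Q.trans y a ν) :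
    (parFrame A P Q).trans (x, y) a (μ.prod ν) :=
  .sync ha hx hy

theorem par_trans_left (ha : a ∉ Act.external '' A) {x : P.State} {μ : FinDist P.State}
    (hx : P.trans x a μ) (y : Q.State) : (parFrame A P Q).trans (x, y) a (μ.map (·, y)) :=
  prod_dirac μ y ▸ ParTrans.left ha hx

theorem par_trans_right (ha : a ∉ Act.external '' A) (x : P.State) {y : Q.State}
    {ν : FinDist Q.State} (hy : Q.trans y a ν) :
    (parFrame A P Q).trans (x, y) a (ν.map (Prod.mk x)) :=
  dirac_prod x ν ▸ ParTrans.right ha hy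

theorem Weak.prod_left (A : Set E) {μ μ' : FinDist P.State} (h : P.Weak μ μ')
    (η : FinDist Q.State) : (parFrame A P Q).Weak (μ.prod η) (μ'.prod η) := by
  rw [prod_eq_iConvexComb_right, prod_eq_iConvexComb_right]
  exact (weak_isConvexRel _).iConvexComb fun y _ =>
    h.map fun _ _ hx => par_trans_left (tau_notMem_external A) hx y

theorem Weak.prod_right (A : Set E) (μ : FinDist P.State) {η η' : FinDist Q.State}
    (h : Q.Weak η η') : (parFrame A P Q).Weak (μ.prod η) (μ.prod η') := by
  rw [prod_eq_iConvexComb, prod_eq_iConvexComb]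
  exact (weak_isConvexRel _).iConvexComb fun x _ =>
    h.map fun _ _ hy => par_trans_right (tau_notMem_external A) x hy

theorem WeakStep.par_sync (ha : a ∈ Act.external '' A) {μ μ' : FinDist P.State} {y : Q.State}
    {η : FinDist Q.State} (h : P.WeakStep a μ μ') (hy : Q.trans y a η) :
    (parFrame A P Q).WeakStep a (μ.map (·, y)) (μ'.prod η) := by
  obtain ⟨μ₁, μ₂, h₁, ⟨n, q, x, ξ, rfl, hξ, rfl⟩, h₃⟩ := h
  refine ⟨_, _, h₁.map fun _ _ hx => par_trans_left (tau_notMem_external A) hx y,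
    lift_map_left_iff.2 ⟨n, q, x, fun i => (ξ i).prod η, rfl, fun i => .inl ?_,
      iConvexComb_prod ..⟩, h₃.prod_left A η⟩
  obtain hi | ⟨rfl, -⟩ := hξ i
  · exact par_trans_sync ha hi hy
  · exact (tau_notMem_external A ha).elim

theorem par_mono_left (A : Set E) (h : P.SimLE P') (Q : PAut.{u} I E) :
    (parFrame A P Q).SimLE (parFrame A P' Q) := by
  let S (s : P.State × Q.State) (ξ : FinDist (P'.State × Q.State)) : Prop :=
    ∃ ν, Similar P P' s.1 ν ∧ ξ = ν.map (·, s.2)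
  have lift_map {μ ν} (h : Lift (Similar P P') μ ν) (y : Q.State) :
      Lift S (μ.map (·, y)) (ν.map (·, y)) :=
    lift_map_left_iff.2 (h.map_right (·, y))
  have lift_prod {μ ν} (h : Lift (Similar P P') μ ν) (η : FinDist Q.State) :
      Lift S (μ.prod η) (ν.prod η) := by
    rw [prod_eq_iConvexComb_right, prod_eq_iConvexComb_right]
    exact .of_iConvexComb fun y _ => lift_map h y
  have sim := isSimRel_similar P P'
  obtain ⟨ν, hweak, hν⟩ := simLE_iff_distSimilar.1 h
  refine ⟨S, ⟨_, lift_prod hν Q.init, hweak.prod_left A Q.init⟩, ?_, ?_⟩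
  · rintro _ a _ _ (@⟨x, y, _, μ, η, ha, hx, hy⟩ | @⟨x, y, _, μ, ha, hx⟩ | @⟨x, y, _, η, ha, hy⟩)
      ⟨ν, hν, rfl⟩
    · obtain ⟨ν', hν', h⟩ := sim.step _ _ _ _ hx hν
      exact ⟨_, hν'.par_sync ha hy, lift_prod h η⟩
    · obtain ⟨ν', hν', h⟩ := sim.step _ _ _ _ hx hν
      exact ⟨_, hν'.map (fun _ _ hx => par_trans_left (tau_notMem_external A) hx y)
        fun _ _ hx => par_trans_left ha hx y, prod_dirac μ y ▸ lift_map h y⟩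
    · refine ⟨ν.prod η, ?_, lift_prod (.of_rel hν) η⟩
      rw [prod_eq_iConvexComb, ← iConvexComb_dirac]
      exact (weakStep_isConvexRel _ a).iConvexComb fun z _ => .of_trans (par_trans_right ha z hy)
  · rintro ⟨x, y⟩ _ ⟨hx, hy⟩ ⟨ν, hν, rfl⟩
    exact (sim.final x ν hx hν).map
      (fun _ _ hx => par_trans_left (tau_notMem_external A) hx y) fun _ hx => ⟨hx, hy⟩

theorem par_comm_le (A : Set E) (P Q : PAut.{u} I E) :
    (parFrame A P Q).SimLE (parFrame A Q P) := by
  refine IsSimMap.simLE (f := Prod.swap) (.of_trans ?_ fun _ => And.symm)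
    (map_swap_prod P.init Q.init ▸ .refl _)
  rintro _ a _ (⟨ha, hx, hy⟩ | ⟨ha, hx⟩ | ⟨ha, hy⟩)
  · simpa [parFrame, map_swap_prod] using par_trans_sync ha hy hx
  · simpa [parFrame] using par_trans_right ha _ hx
  · simpa [parFrame] using par_trans_left ha hy _

theorem par_comm_equiv (A : Set E) (P Q : PAut.{u} I E) :
    (parFrame A P Q).SimEquiv (parFrame A Q P) :=
  ⟨par_comm_le A P Q, par_comm_le A Q P⟩

theorem par_mono (A : Set E) (hP : P.SimLE P') (hQ : Q.SimLE Q') :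
    (parFrame A P Q).SimLE (parFrame A P' Q') :=
  (par_mono_left A hP Q).trans <| (par_comm_le A P' Q).trans <|
    (par_mono_left A hQ P').trans (par_comm_le A Q' P')

theorem par_assoc_le (A : Set E) (P Q R : PAut.{u} I E) :
    (parFrame A P (parFrame A Q R)).SimLE (parFrame A (parFrame A P Q) R) := by
  refine IsSimMap.simLE (f := (Equiv.prodAssoc ..).symm)
    (.of_trans ?_ fun _ h => ⟨⟨h.1, h.2.1⟩, h.2.2⟩)
    (map_prodAssoc_symm_prod P.init Q.init R.init ▸ .refl _)
  rintro _ a _ (⟨ha, hx, ⟨-, hy, hz⟩ | ⟨ha', -⟩ | ⟨ha', -⟩⟩ | @⟨_, ⟨y, z⟩, _, μ, ha, hx⟩ |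
    ⟨ha, ⟨ha', -⟩ | ⟨-, hy⟩ | ⟨-, hz⟩⟩)
  · simpa [parFrame] using par_trans_sync ha (par_trans_sync ha hx hy) hz
  · exact (ha' ha).elim
  · exact (ha' ha).elim
  · simpa [parFrame] using par_trans_left ha (par_trans_left ha hx y) z
  · exact (ha ha').elim
  · simpa [parFrame] using par_trans_left ha (par_trans_right ha _ hy) _
  · simpa [parFrame] using par_trans_right ha (P := parFrame A P Q) _ hz

theorem par_assoc_equiv (A : Set E) (P Q R : PAut.{u} I E) :
    (parFrame A P (parFrame A Q R)).SimEquiv (parFrame A (parFrame A P Q) R) := by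
  refine ⟨par_assoc_le A P Q R, ?_⟩
  exact (par_comm_le A _ R).trans <| (par_mono A (.refl R) (par_comm_le A P Q)).trans <|
    (par_assoc_le A R Q P).trans <|
      (par_comm_le A _ P).trans (par_mono A (.refl P) (par_comm_le A R Q))

theorem par_seq_par_le (A : Set E) (P Q P' Q' : PAut.{u} I E) :
    ((parFrame A P Q).seq (parFrame A P' Q')).SimLE
      (parFrame A (P.seq P') (Q.seq Q')) := by
  have inr_map : IsSimMap (parFrame A P' Q') (parFrame A (P.seq P') (Q.seq Q'))
      fun s => (Sum.inr s.1, Sum.inr s.2) := by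
    refine .of_trans ?_ fun s hs => ⟨⟨_, hs.1, rfl⟩, ⟨_, hs.2, rfl⟩⟩
    rintro _ a _ (⟨ha, hx, hy⟩ | ⟨ha, hx⟩ | ⟨ha, hy⟩)
    · simpa [parFrame, seq] using par_trans_sync ha (seq_trans_inr P hx) (seq_trans_inr Q hy)
    · simpa [parFrame, seq] using par_trans_left (Q := Q.seq Q') ha (seq_trans_inr P hx) (Sum.inr _)
    · simpa [parFrame, seq] using
        par_trans_right (P := P.seq P') ha (Sum.inr _) (seq_trans_inr Q hy)
  refine seq_le_of_map (fun s => (Sum.inl s.1, Sum.inl s.2))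
    (by simpa [parFrame, seq] using .refl _) ?_ ?_
  · rintro _ a _ (⟨ha, hx, hy⟩ | ⟨ha, hx⟩ | ⟨ha, hy⟩)
    · simpa [parFrame, seq] using
        WeakStep.of_trans (par_trans_sync ha (seq_trans_inl hx P') (seq_trans_inl hy Q'))
    · simpa [parFrame, seq] using WeakStep.of_trans
        (par_trans_left (Q := Q.seq Q') ha (seq_trans_inl hx P') (Sum.inl _))
    · simpa [parFrame, seq] using WeakStep.of_trans
        (par_trans_right (P := P.seq P') ha (Sum.inl _) (seq_trans_inl hy Q'))
  · rintro ⟨x, y⟩ ⟨hx, hy⟩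
    have pass₁ := (Weak.of_trans (seq_trans_pass hx P')).prod_left A (dirac (Sum.inl y))
      (Q := Q.seq Q')
    have pass₂ := (Weak.of_trans (seq_trans_pass hy Q')).prod_right A (P := P.seq P')
      (P'.init.map Sum.inr)
    refine .of_weak ?_ (inr_map.distSimilar _)
    have pass : (parFrame A (P.seq P') (Q.seq Q')).Weak _ _ := pass₁.trans pass₂
    simpa [parFrame, seq] using pass

theorem par_choice_equiv (A : Set E) (p : unitInterval) (P Q R : PAut.{u} I E) :
    (choice p (parFrame A P Q) (parFrame A P R)).SimEquiv (parFrame A P (choice p Q R)) := by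
  constructor
  · refine IsSimMap.simLE (f := Sum.elim (fun s => (s.1, Sum.inl s.2)) fun s => (s.1, Sum.inr s.2))
      (.of_trans ?_ ?_) (by simpa [parFrame, choice] using .refl _)
    · rintro _ a _ ((⟨ha, hx, hy⟩ | ⟨ha, hx⟩ | ⟨ha, hy⟩) | (⟨ha, hx, hy⟩ | ⟨ha, hx⟩ | ⟨ha, hy⟩))
      · simpa [parFrame, choice] using par_trans_sync ha hx (choice_trans_inl p hy R)
      · simpa [parFrame, choice] using par_trans_left (Q := choice p Q R) ha hx (Sum.inl _)
      · simpa [parFrame, choice] using par_trans_right ha _ (choice_trans_inl p hy R)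
      · simpa [parFrame, choice] using par_trans_sync ha hx (choice_trans_inr p Q hy)
      · simpa [parFrame, choice] using par_trans_left (Q := choice p Q R) ha hx (Sum.inr _)
      · simpa [parFrame, choice] using par_trans_right ha _ (choice_trans_inr p Q hy)
    · rintro _ (⟨s, hs, rfl⟩ | ⟨s, hs, rfl⟩)
      · exact ⟨hs.1, .inl ⟨_, hs.2, rfl⟩⟩
      · exact ⟨hs.1, .inr ⟨_, hs.2, rfl⟩⟩
  · refine IsSimMap.simLE (f := fun s => Sum.map (Prod.mk s.1) (Prod.mk s.1) s.2)
      (.of_trans ?_ ?_) (by simpa [parFrame, choice] using .refl _)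
    · rintro _ a _ (⟨ha, hx, hy | hy⟩ | @⟨x, y | y, _, μ, ha, hx⟩ | ⟨ha, hy | hy⟩)
      · simpa [parFrame, choice] using choice_trans_inl p (par_trans_sync ha hx hy) (parFrame A P R)
      · simpa [parFrame, choice] using choice_trans_inr p (parFrame A P Q) (par_trans_sync ha hx hy)
      · simpa [parFrame, choice] using choice_trans_inl p (par_trans_left ha hx y) (parFrame A P R)
      · simpa [parFrame, choice] using choice_trans_inr p (parFrame A P Q) (par_trans_left ha hx y)
      · simpa [parFrame, choice] using choice_trans_inl p (par_trans_right ha _ hy) (parFrame A P R)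
      · simpa [parFrame, choice] using choice_trans_inr p (parFrame A P Q) (par_trans_right ha _ hy)
    · rintro ⟨x, _⟩ ⟨hx, ⟨y, hy, rfl⟩ | ⟨y, hy, rfl⟩⟩
      · exact .inl ⟨_, ⟨hx, hy⟩, rfl⟩
      · exact .inr ⟨_, ⟨hx, hy⟩, rfl⟩

theorem par_add_par_le (A : Set E) (P Q R : PAut.{u} I E) :
    ((parFrame A P Q).add (parFrame A P R)).SimLE (parFrame A P (Q.add R)) :=
  add_le (par_mono A (.refl P) (le_add_left Q R)) (par_mono A (.refl P) (le_add_right Q R))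

end Par

/-! ### The algebra of automata up to simulation equivalence -/

/-- Simulation equivalence as a setoid. -/
def simSetoid (I : Type v) (E : Type w) : Setoid (PAut.{u} I E) where
  r := SimEquiv
  iseqv := ⟨fun P => ⟨.refl P, .refl P⟩, And.symm,
    fun h h' => ⟨h.1.trans h'.1, h'.2.trans h.2⟩⟩

theorem mk_eq_iff : Quotient.mk (simSetoid I E) P = Quotient.mk _ Q ↔ P.SimEquiv Q :=
  Quotient.eq

theorem mk_add_eq_iff :
    Quotient.mk (simSetoid I E) (P.add Q) = Quotient.mk _ Q ↔ P.SimLE Q :=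
  mk_eq_iff.trans add_equiv_right_iff

/-- The probabilistic concurrent Kleene algebra of automata up to simulation equivalence, in which
the parallel composition synchronises on the external actions in `A`. It is not an instance since
the quotient does not determine `A`. -/
@[reducible] def simAlgebra (I : Type v) (E : Type w) (A : Set E) :
    ProbConcurrentKleeneAlgebra (Quotient (simSetoid.{u} I E)) where
  add := Quotient.map₂ add fun _ _ h _ _ h' => ⟨add_mono h.1 h'.1, add_mono h.2 h'.2⟩
  mul := Quotient.map₂ seq fun _ _ h _ _ h' => ⟨seq_mono h.1 h'.1, seq_mono h.2 h'.2⟩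
  zero := Quotient.mk _ deadlock
  one := Quotient.mk _ skip
  par := Quotient.map₂ (parFrame A) fun _ _ h _ _ h' =>
    ⟨par_mono A h.1 h'.1, par_mono A h.2 h'.2⟩
  star := Quotient.map star fun _ _ h => ⟨star_mono h.1, star_mono h.2⟩
  choice p := Quotient.map₂ (choice p) fun _ _ h _ _ h' =>
    ⟨choice_mono p h.1 h'.1, choice_mono p h.2 h'.2⟩
  add_idem := by rintro ⟨P⟩; exact mk_eq_iff.2 (add_self_equiv P)
  add_deadlock := by rintro ⟨P⟩; exact mk_eq_iff.2 (add_deadlock_equiv P)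
  add_comm := by rintro ⟨P⟩ ⟨Q⟩; exact mk_eq_iff.2 (add_comm_equiv P Q)
  add_assoc := by rintro ⟨P⟩ ⟨Q⟩ ⟨R⟩; exact mk_eq_iff.2 (add_assoc_equiv P Q R)
  mul_skip := by rintro ⟨P⟩; exact mk_eq_iff.2 (seq_skip_equiv P)
  skip_mul := by rintro ⟨P⟩; exact mk_eq_iff.2 (skip_seq_equiv P)
  deadlock_mul := by rintro ⟨P⟩; exact mk_eq_iff.2 (deadlock_seq_equiv P)
  mul_assoc := by rintro ⟨P⟩ ⟨Q⟩ ⟨R⟩; exact mk_eq_iff.2 (seq_assoc_equiv P Q R)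
  add_mul := by rintro ⟨P⟩ ⟨Q⟩ ⟨R⟩; exact mk_eq_iff.2 (add_seq_equiv P Q R)
  mul_add_sub := by rintro ⟨P⟩ ⟨Q⟩ ⟨R⟩; exact mk_add_eq_iff.2 (seq_add_seq_le P Q R)
  star_unfold := by rintro ⟨P⟩; exact mk_eq_iff.2 (star_unfold_equiv P)
  star_induction := by
    rintro ⟨P⟩ ⟨Q⟩ h
    exact mk_add_eq_iff.2 (star_seq_le (mk_add_eq_iff.1 h))
  par_comm := by rintro ⟨P⟩ ⟨Q⟩; exact mk_eq_iff.2 (par_comm_equiv A P Q)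
  par_assoc := by rintro ⟨P⟩ ⟨Q⟩ ⟨R⟩; exact mk_eq_iff.2 (par_assoc_equiv A P Q R)
  exchange := by rintro ⟨P⟩ ⟨Q⟩ ⟨P'⟩ ⟨Q'⟩; exact mk_add_eq_iff.2 (par_seq_par_le A P Q P' Q')
  par_add_sub := by rintro ⟨P⟩ ⟨Q⟩ ⟨R⟩; exact mk_add_eq_iff.2 (par_add_par_le A P Q R)
  choice_idem := by rintro p ⟨P⟩; exact mk_eq_iff.2 (choice_self_equiv p P)
  choice_comm := by rintro p ⟨P⟩ ⟨Q⟩; exact mk_eq_iff.2 (choice_comm_equiv p P Q)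
  choice_assoc := by
    rintro p q p' q' ⟨P⟩ ⟨Q⟩ ⟨R⟩ h₁ h₂ h₃
    exact mk_eq_iff.2 (choice_assoc_equiv h₁ h₂ h₃ P Q R)
  choice_mul := by rintro p ⟨P⟩ ⟨Q⟩ ⟨R⟩; exact mk_eq_iff.2 (choice_seq_equiv p P Q R)
  mul_choice_sub := by rintro p ⟨P⟩ ⟨Q⟩ ⟨R⟩; exact mk_add_eq_iff.2 (seq_choice_le p P Q R)
  par_choice := by rintro p ⟨P⟩ ⟨Q⟩ ⟨R⟩; exact mk_eq_iff.2 (par_choice_equiv A p P Q R)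

end PAut

end

theorem mainTheorem1_general (I : Type v) (E : Type w) (A : Set E) :
    ∃ (s : Setoid (PAut.{u} I E)) (_ : ProbConcurrentKleeneAlgebra (Quotient s)),
      (∀ P Q : PAut.{u} I E, s P Q ↔ PAut.SimEquiv P Q) ∧
      (∀ P Q : PAut.{u} I E,
        (Quotient.mk s P + Quotient.mk s Q = Quotient.mk s Q ↔ PAut.SimLE P Q)) ∧
      Quotient.mk s PAut.deadlock = 0 ∧
      Quotient.mk s PAut.skip = 1 ∧
      (∀ P Q : PAut.{u} I E, Quotient.mk s (P.add Q) = Quotient.mk s P + Quotient.mk s Q) ∧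
      (∀ P Q : PAut.{u} I E, Quotient.mk s (P.seq Q) = Quotient.mk s P * Quotient.mk s Q) ∧
      (∀ P Q : PAut.{u} I E, Quotient.mk s (PAut.parFrame A P Q) =
        WeakConcurrentKleeneAlgebra.par (Quotient.mk s P) (Quotient.mk s Q)) ∧
      (∀ P : PAut.{u} I E,
        Quotient.mk s P.star = WeakConcurrentKleeneAlgebra.star (Quotient.mk s P)) ∧
      (∀ (p : unitInterval) (P Q : PAut.{u} I E), Quotient.mk s (PAut.choice p P Q) =
        ProbConcurrentKleeneAlgebra.choice p (Quotient.mk s P) (Quotient.mk s Q)) :=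
  ⟨PAut.simSetoid I E, PAut.simAlgebra I E A, fun _ _ => Iff.rfl, fun _ _ => PAut.mk_add_eq_iff,
    rfl, rfl, fun _ _ => rfl, fun _ _ => rfl, fun _ _ => rfl, fun _ => rfl, fun _ _ _ => rfl⟩

theorem mainTheorem1 (I : Type v) (E : Type w) :
    ∃ (s : Setoid (PAut.{u} I E)) (_ : ProbConcurrentKleeneAlgebra (Quotient s)),
      (∀ P Q : PAut.{u} I E, s P Q ↔ PAut.SimEquiv P Q) ∧
      (∀ P Q : PAut.{u} I E,
        (Quotient.mk s P + Quotient.mk s Q = Quotient.mk s Q ↔ PAut.SimLE P Q)) ∧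
      Quotient.mk s PAut.deadlock = 0 ∧
      Quotient.mk s PAut.skip = 1 ∧
      (∀ P Q : PAut.{u} I E, Quotient.mk s (P.add Q) = Quotient.mk s P + Quotient.mk s Q) ∧
      (∀ P Q : PAut.{u} I E, Quotient.mk s (P.seq Q) = Quotient.mk s P * Quotient.mk s Q) ∧
      (∀ P Q : PAut.{u} I E, Quotient.mk s (P.par Q) =
        WeakConcurrentKleeneAlgebra.par (Quotient.mk s P) (Quotient.mk s Q)) ∧
      (∀ P : PAut.{u} I E,
        Quotient.mk s P.star = WeakConcurrentKleeneAlgebra.star (Quotient.mk s P)) ∧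
      (∀ (p : unitInterval) (P Q : PAut.{u} I E), Quotient.mk s (PAut.choice p P Q) =
        ProbConcurrentKleeneAlgebra.choice p (Quotient.mk s P) (Quotient.mk s Q)) :=
  mainTheorem1_general I E Set.univ
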